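/- **Setting.** Fix $d\ge 1$ and constants $A,B\ge 0$, $C,L$, and let $P=C+AB$. Let $\theta^s,\theta^b\in\mathbb R^d$ with $\|\theta^s\|,\|\theta^b\|\le A$, and let $x_1,x_2,\dots\in\mathbb R^d$ with $\|x_t\|\le B$ be contexts fixed in advance by an oblivious adversary. In round $t$ the seller's and the buyer's valuations are $s_t=x_t^\top\theta^s+\xi^s_t$ and $b_t=x_t^\top\theta^b+\xi^b_t$. The noise terms $\xi^s_1,\xi^s_2,\dots$ are i.i.d., and so are $\xi^b_1,\xi^b_2,\dots$; all of them are mutually independent and independent of the learner's randomization. They are centered, supported in $[-C,C]$, and have densities bounded by $L$. The learner observes $x_t$, posts the same price $p_t$ to both agents (strong budget balance), and then observes the two bits $\mathbb 1\{s_t\le p_t\}$ and $\mathbb 1\{p_t\le b_t\}$. Put $\mathrm{EGFT}(x,p,q)=\mathbb E\big[\mathbb 1\{s\le p\}\,\mathbb 1\{q\le b\}\,(b-s)\big]$ with $s=x^\top\theta^s+\xi^s$, $b=x^\top\theta^b+\xi^b$, $\mathrm{EGFT}(x,p)=\mathrm{EGFT}(x,p,p)$, and $$R_T=\sum_{t=1}^T\max_{-P\le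 p\le q\le P}\mathrm{EGFT}(x_t,p,q)-\sum_{t=1}^T\mathrm{EGFT}(x_t,p_t).$$ **Algorithm EOC-BT** with inputs $\epsilon,\mu,T^{\rm int},T^{\rm FD}$. Let $K=\lceil 2P/\epsilon\rceil+3$, $\mathcal K=\{-K,\dots,K\}$. Sets of rounds $\mathcal T^{\rm par},\mathcal T^{\rm int},\mathcal T^F_k,\mathcal T^D_k$ $(k\in\mathcal K)$ are initially empty. At all times, over the current set $\mathcal T^{\rm par}$, $$V=I_d+\sum_{l\in\mathcal T^{\rm par}}x_lx_l^\top,\quad \hat\theta^s=2PV^{-1}\sum_{l\in\mathcal T^{\rm par}}\big(\mathbb 1\{p_l<s_l\}-\tfrac12\big)x_l,\quad \hat\theta^b=2PV^{-1}\sum_{l\in\mathcal T^{\rm par}}\big(\mathbb 1\{p_l\le b_l\}-\tfrac12\big)x_l .$$ In round $t$: 1. If $\sqrt{x_t^\top V^{-1}x_t}>\mu$: post $p_t$ uniform on $[-P,P]$ and add $t$ to $\mathcal T^{\rm par}$. 2. Else if $|\mathcal T^{\rm int}|<T^{\rm int}$: post $p_t$ uniform on $[-P,P]$, add $t$ to $\mathcal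 T^{\rm int}$, and for all $k\in\mathcal K$ set, with the current $\hat\theta^s,\hat\theta^b$, $$\hat I^k=\frac{2P}{|\mathcal T^{\rm int}|}\sum_{l\in\mathcal T^{\rm int}}\mathbb 1\{k\epsilon+x_l^\top\hat\theta^b\le p_l\le b_l\},\qquad \hat J^k=\frac{2P}{|\mathcal T^{\rm int}|}\sum_{l\in\mathcal T^{\rm int}}\mathbb 1\{s_l\le p_l\le k\epsilon+x_l^\top\hat\theta^s\}.$$ 3. Else if $|\mathcal T^F_k|<T^{\rm FD}$ or $|\mathcal T^D_k|<T^{\rm FD}$ for some $k\in\mathcal K$: pick such a $k$. If $|\mathcal T^F_k|<T^{\rm FD}$, post $p_t=x_t^\top\hat\theta^s+k\epsilon$ and add $t$ to $\mathcal T^F_k$; otherwise post $p_t=x_t^\top\hat\theta^b+k\epsilon$ and add $t$ to $\mathcal T^D_k$. Let $\hat F^k$ be the average of $\mathbb 1\{s_l\le p_l\}$ over $l\in\mathcal T^F_k$, and $\hat D^k$ the average of $\mathbb 1\{p_l\le b_l\}$ over $l\in\mathcal T^D_k$. 4. Else (commit): let $\mathcal A_t=\{(k,k')\in\mathcal K^2: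 k'=\lfloor (k\epsilon-x_t^\top(\hat\theta^b-\hat\theta^s))/\epsilon\rfloor\}$, choose $(k_t,k_t')\in\arg\max_{(k,k')\in\mathcal A_t}\hat F^k\hat I^{k'}+\hat D^{k'}\hat J^k$ (arbitrarily if $\mathcal A_t=\varnothing$), and post $p_t=x_t^\top\hat\theta^s+k_t\epsilon$. The uniform draws are independent. The grid point in step 3 and the maximizer in step 4 may be selected by any rules that depend on the round and on the set of admissible candidates. Rounds of kinds 1–3 are exploration rounds. **Theorem.** There is an absolute constant $\kappa$, and for all $d,A,B,C,L$ there are constants $c$ and $\widetilde T$, such that the following holds for every $T\ge\widetilde T$ and every instance as above. Run EOC-BT with $$\epsilon=(\log (T)/T)^{1/4},\quad \delta=\big(T(74+32P\epsilon^{-1})\big)^{-1},\quad \mu=\epsilon\Big(P\sqrt{d\log\tfrac{1+B^2T}{\delta}}+A\Big)^{-1},$$ $$T^{\rm int}=\lceil 8P^2\log(1/\delta)\epsilon^{-2}\rceil,\quad T^{\rm FD}=\lceil 2\log(1/\delta)\epsilon^{-2}\rceil .$$ Then the number of exploration rounds among the first $T$ rounds is always at most $c\,T^{3/4}(\log T)^\kappa$,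 and with probability at least $1-1/T$, $$R_T\le c\,T^{3/4}(\log T)^\kappa .$$ -/

import Mathlib

open MeasureTheory ProbabilityTheory
open scoped RealInnerProductSpace

noncomputable section

namespace BilateralTrade

/-! ## The market -/

/-- Law of a noise term: a centered probability law carried by `[-C, C]`, with a density
with respect to Lebesgue measure that is bounded by `L`. -/
structure IsNoiseLaw (C L : ℝ) (ν : Measure ℝ) : Prop where
  isProb : IsProbabilityMeasure ν
  support : ν (Set.Icc (-C) C)ᶜ = 0
  centered : ∫ u, u ∂ν = 0
  density : ∃ f : ℝ → ℝ, Measurable f ∧ (∀ u, 0 ≤ f u ∧ f u ≤ L) ∧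
    ν = volume.withDensity (fun u => ENNReal.ofReal (f u))

/-- Gain from trade for valuations `s` (seller) and `b` (buyer) when `p` is posted to the
seller and `q` to the buyer. -/
def gft (s b p q : ℝ) : ℝ :=
  if s ≤ p ∧ q ≤ b then b - s else 0

variable {d : ℕ}

/-- Expected gain from trade at context `x` and prices `(p, q)`: the seller's valuation is
`⟪x, θs⟫ + z.1` and the buyer's is `⟪x, θb⟫ + z.2`, where `z.1 ∼ νs` and `z.2 ∼ νb` are
independent. -/
def egft (θs θb : EuclideanSpace ℝ (Fin d)) (νs νb : Measure ℝ)
    (x : EuclideanSpace ℝ (Fin d)) (p q : ℝ) : ℝ :=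
  ∫ z : ℝ × ℝ, gft (⟪x, θs⟫ + z.1) (⟪x, θb⟫ + z.2) p q ∂(νs.prod νb)

/-- The benchmark at context `x`: the best expected gain from trade over pairs of prices
`p ≤ q` in `[-P, P]`. -/
def bestEgft (P : ℝ) (θs θb : EuclideanSpace ℝ (Fin d)) (νs νb : Measure ℝ)
    (x : EuclideanSpace ℝ (Fin d)) : ℝ :=
  sSup {g : ℝ | ∃ p ∈ Set.Icc (-P) P, ∃ q ∈ Set.Icc (-P) P, p ≤ q ∧
    g = egft θs θb νs νb x p q}

/-- Pseudo-regret over the rounds `0, …, T - 1` of the prices `p t`, posted to both agents. -/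
def regret (P : ℝ) (θs θb : EuclideanSpace ℝ (Fin d)) (νs νb : Measure ℝ)
    (x : ℕ → EuclideanSpace ℝ (Fin d)) (p : ℕ → ℝ) (T : ℕ) : ℝ :=
  ∑ t ∈ Finset.range T, bestEgft P θs θb νs νb (x t)
    - ∑ t ∈ Finset.range T, egft θs θb νs νb (x t) (p t) (p t)

/-! ## The algorithm Explore-Or-Commit for Bilateral Trade -/

/-- Inputs of the algorithm. -/
structure Config where
  /-- uniform prices are drawn from `[-P, P]` -/
  P : ℝ
  /-- discretization size -/
  eps : ℝ
  /-- threshold of the parameter exploration -/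
  mu : ℝ
  /-- length of the exploration phase for the integrals -/
  Tint : ℕ
  /-- length of each exploration phase for a value of the c.d.f. or of the demand function -/
  TFD : ℕ

/-- `K = ⌈2P/ε⌉ + 3`. -/
def Config.K (cfg : Config) : ℕ := ⌈2 * cfg.P / cfg.eps⌉₊ + 3

/-- The grid `{-K, …, K}`. -/
def Config.grid (cfg : Config) : Finset ℤ := Finset.Icc (-(cfg.K : ℤ)) (cfg.K : ℤ)

/-- What the learner knows about a past round: the context, the price it posted to both agents,
and the two bits of feedback. -/
structure Obs (d : ℕ) where
  x : EuclideanSpace ℝ (Fin d)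
  price : ℝ
  /-- the bit `𝟙{s ≤ p}` -/
  sellerAccepts : Bool
  /-- the bit `𝟙{p ≤ b}` -/
  buyerAccepts : Bool

/-- The memory of the learner. -/
structure State (d : ℕ) where
  /-- observations of the past rounds -/
  hist : ℕ → Obs d
  /-- rounds spent on estimating the parameters -/
  Tpar : Finset ℕ
  /-- rounds spent on estimating the integrals -/
  Tint : Finset ℕ
  /-- rounds spent on estimating the seller's c.d.f. at the `k`-th grid point -/
  TF : ℤ → Finset ℕ
  /-- rounds spent on estimating the buyer's demand function at the `k`-th grid point -/
  TD : ℤ → Finset ℕ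
  /-- current estimates of `I(kε)` -/
  Ihat : ℤ → ℝ
  /-- current estimates of `J(kε)` -/
  Jhat : ℤ → ℝ

/-- The initial memory (the entries of `hist` are placeholders that are never read). -/
def State.init (d : ℕ) : State d where
  hist := fun _ => ⟨0, 0, false, false⟩
  Tpar := ∅
  Tint := ∅
  TF := fun _ => ∅
  TD := fun _ => ∅
  Ihat := fun _ => 0
  Jhat := fun _ => 0

/-- `V = I + ∑_{l ∈ Tpar} x_l x_lᵀ`. -/
def State.V (S : State d) : Matrix (Fin d) (Fin d) ℝ :=
  1 + ∑ l ∈ S.Tpar, Matrix.vecMulVec (S.hist l).x.ofLp (S.hist l).x.ofLp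

/-- `‖x‖_M = √(xᵀ M x)`. -/
def matNorm (M : Matrix (Fin d) (Fin d) ℝ) (x : EuclideanSpace ℝ (Fin d)) : ℝ :=
  √(x.ofLp ⬝ᵥ (M.mulVec x.ofLp))

/-- `θ̂ˢ = 2P V⁻¹ ∑_{l ∈ Tpar} (𝟙{p_l < s_l} - 1/2) x_l`; the indicator is the negation of the
seller's bit. -/
def State.thetaS (cfg : Config) (S : State d) : EuclideanSpace ℝ (Fin d) :=
  WithLp.toLp 2 ((2 * cfg.P) • (S.V⁻¹).mulVec (∑ l ∈ S.Tpar,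
    ((if (S.hist l).sellerAccepts then (0 : ℝ) else 1) - 1 / 2) • (S.hist l).x.ofLp))

/-- `θ̂ᵇ = 2P V⁻¹ ∑_{l ∈ Tpar} (𝟙{p_l ≤ b_l} - 1/2) x_l`. -/
def State.thetaB (cfg : Config) (S : State d) : EuclideanSpace ℝ (Fin d) :=
  WithLp.toLp 2 ((2 * cfg.P) • (S.V⁻¹).mulVec (∑ l ∈ S.Tpar,
    ((if (S.hist l).buyerAccepts then (1 : ℝ) else 0) - 1 / 2) • (S.hist l).x.ofLp))

/-- `(2P / |Tint|) ∑_{l ∈ Tint} 𝟙{kε + x_lᵀθ̂ᵇ ≤ p_l ≤ b_l}`. -/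
def State.estI (cfg : Config) (S : State d) (k : ℤ) : ℝ :=
  2 * cfg.P / (S.Tint.card : ℝ) * ∑ l ∈ S.Tint,
    if k * cfg.eps + ⟪(S.hist l).x, S.thetaB cfg⟫ ≤ (S.hist l).price ∧
      (S.hist l).buyerAccepts then (1 : ℝ) else 0

/-- `(2P / |Tint|) ∑_{l ∈ Tint} 𝟙{s_l ≤ p_l ≤ kε + x_lᵀθ̂ˢ}`. -/
def State.estJ (cfg : Config) (S : State d) (k : ℤ) : ℝ :=
  2 * cfg.P / (S.Tint.card : ℝ) * ∑ l ∈ S.Tint,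
    if (S.hist l).sellerAccepts ∧
      (S.hist l).price ≤ k * cfg.eps + ⟪(S.hist l).x, S.thetaS cfg⟫ then (1 : ℝ) else 0

/-- Empirical estimate of the seller's c.d.f. at `kε`. -/
def State.Fhat (S : State d) (k : ℤ) : ℝ :=
  (∑ l ∈ S.TF k, if (S.hist l).sellerAccepts then (1 : ℝ) else 0) / ((S.TF k).card : ℝ)

/-- Empirical estimate of the buyer's demand function at `kε`. -/
def State.Dhat (S : State d) (k : ℤ) : ℝ :=
  (∑ l ∈ S.TD k, if (S.hist l).buyerAccepts then (1 : ℝ) else 0) / ((S.TD k).card : ℝ)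

/-- Grid points at which the c.d.f. or the demand function still has to be sampled. -/
def State.unfinished (cfg : Config) (S : State d) : Finset ℤ :=
  cfg.grid.filter (fun k => (S.TF k).card < cfg.TFD ∨ (S.TD k).card < cfg.TFD)

/-- The set `A_t` of the pairs `(k, k')` of grid points with
`k' = ⌊(kε - xᵀ(θ̂ᵇ - θ̂ˢ)) / ε⌋`. -/
def State.pairs (cfg : Config) (S : State d) (x : EuclideanSpace ℝ (Fin d)) : Finset (ℤ × ℤ) :=
  (cfg.grid ×ˢ cfg.grid).filter (fun a =>
    a.2 = ⌊(a.1 * cfg.eps - ⟪x, S.thetaB cfg - S.thetaS cfg⟫) / cfg.eps⌋)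

/-- Estimated expected gain from trade of a pair `(k, k')`. -/
def State.score (S : State d) (a : ℤ × ℤ) : ℝ :=
  S.Fhat a.1 * S.Ihat a.2 + S.Dhat a.2 * S.Jhat a.1

/-- The maximizers of the score over `A_t`. -/
def State.best (cfg : Config) (S : State d) (x : EuclideanSpace ℝ (Fin d)) : Finset (ℤ × ℤ) :=
  (S.pairs cfg x).filter (fun a => ∀ a' ∈ S.pairs cfg x, S.score a' ≤ S.score a)

/-- The kinds of rounds. -/
inductive Phase where
  | estPar
  | estInt
  | estF (k : ℤ)
  | estD (k : ℤ)
  | commit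
deriving DecidableEq

/-- The choices that the description of the algorithm leaves open: `pick t s` is the grid point
taken in round `t` from the set `s` of unfinished grid points, and `tie t s` is the element taken
in round `t` from the set `s` of maximizers. Both are unconstrained on the empty set. -/
structure Choice where
  pick : ℕ → Finset ℤ → ℤ
  pick_mem : ∀ t s, s.Nonempty → pick t s ∈ s
  tie : ℕ → Finset (ℤ × ℤ) → ℤ × ℤ
  tie_mem : ∀ t s, s.Nonempty → tie t s ∈ s

/-- The kind of round `t`, given the memory and the current context. -/
def State.phase (cfg : Config) (ch : Choice) (t : ℕ) (S : State d)
    (x : EuclideanSpace ℝ (Fin d)) : Phase :=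
  if cfg.mu < matNorm S.V⁻¹ x then .estPar
  else if S.Tint.card < cfg.Tint then .estInt
  else if (S.unfinished cfg).Nonempty then
    if (S.TF (ch.pick t (S.unfinished cfg))).card < cfg.TFD
    then .estF (ch.pick t (S.unfinished cfg))
    else .estD (ch.pick t (S.unfinished cfg))
  else .commit

/-- The price posted to both agents in a round of the given kind; `u` is the fresh uniform draw. -/
def State.post (cfg : Config) (ch : Choice) (t : ℕ) (S : State d)
    (x : EuclideanSpace ℝ (Fin d)) (u : ℝ) : Phase → ℝ
  | .estPar => u
  | .estInt => u
  | .estF k => ⟪x, S.thetaS cfg⟫ + k * cfg.eps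
  | .estD k => ⟪x, S.thetaB cfg⟫ + k * cfg.eps
  | .commit => ⟪x, S.thetaS cfg⟫ + (ch.tie t (S.best cfg x)).1 * cfg.eps

/-- Store the observation `o` of round `t`. -/
def State.record (S : State d) (t : ℕ) (o : Obs d) : State d :=
  { S with hist := Function.update S.hist t o }

/-- Recompute the estimates of the integrals, with the current estimates of the parameters. -/
def State.refreshInt (cfg : Config) (S : State d) : State d :=
  { S with Ihat := S.estI cfg, Jhat := S.estJ cfg }

/-- The memory after round `t`, which was of the given kind and led to the observation `o`. -/
def State.update (cfg : Config) (S : State d) (t : ℕ) (o : Obs d) : Phase → State d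
  | .estPar => { S.record t o with Tpar := insert t S.Tpar }
  | .estInt => State.refreshInt cfg { S.record t o with Tint := insert t S.Tint }
  | .estF k => { S.record t o with TF := Function.update S.TF k (insert t (S.TF k)) }
  | .estD k => { S.record t o with TD := Function.update S.TD k (insert t (S.TD k)) }
  | .commit => S.record t o

/-- One round of the algorithm against a seller of valuation `s` and a buyer of valuation `b`. -/
def State.next (cfg : Config) (ch : Choice) (t : ℕ) (S : State d)
    (x : EuclideanSpace ℝ (Fin d)) (u s b : ℝ) : State d :=
  let φ := S.phase cfg ch t x
  let p := S.post cfg ch t x u φ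
  S.update cfg t ⟨x, p, decide (s ≤ p), decide (p ≤ b)⟩ φ

/-- The memory at the beginning of round `t`, for contexts `x`, uniform draws `u`, and valuations
`s` (sellers) and `b` (buyers). -/
def stateAt (cfg : Config) (ch : Choice) (x : ℕ → EuclideanSpace ℝ (Fin d)) (u s b : ℕ → ℝ) :
    ℕ → State d
  | 0 => State.init d
  | t + 1 => (stateAt cfg ch x u s b t).next cfg ch t (x t) (u t) (s t) (b t)

/-- The kind of round `t`. -/
def phaseAt (cfg : Config) (ch : Choice) (x : ℕ → EuclideanSpace ℝ (Fin d)) (u s b : ℕ → ℝ)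
    (t : ℕ) : Phase :=
  (stateAt cfg ch x u s b t).phase cfg ch t (x t)

/-- The price posted to both agents in round `t`. -/
def priceAt (cfg : Config) (ch : Choice) (x : ℕ → EuclideanSpace ℝ (Fin d)) (u s b : ℕ → ℝ)
    (t : ℕ) : ℝ :=
  (stateAt cfg ch x u s b t).post cfg ch t (x t) (u t) (phaseAt cfg ch x u s b t)

/-- The number of exploration rounds among the rounds `0, …, T - 1`. -/
def explorationRounds (cfg : Config) (ch : Choice) (x : ℕ → EuclideanSpace ℝ (Fin d))
    (u s b : ℕ → ℝ) (T : ℕ) : ℕ :=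
  ((Finset.range T).filter (fun t => phaseAt cfg ch x u s b t ≠ Phase.commit)).card

/-! ## The choice of the inputs -/

/-- `ε = (log T / T)^{1/4}`. -/
def epsOf (T : ℕ) : ℝ := (Real.log T / T) ^ (1 / 4 : ℝ)

/-- `δ = (T (74 + 32 P ε⁻¹))⁻¹`. -/
def deltaOf (P : ℝ) (T : ℕ) : ℝ := (T * (74 + 32 * P * (epsOf T)⁻¹))⁻¹

/-- The inputs of the algorithm for horizon `T`, with `P = C + AB`,
`μ = ε (P √(d log((1 + B² T) / δ)) + A)⁻¹`, `Tint = ⌈8 P² log(1/δ) ε⁻²⌉` and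
`TFD = ⌈2 log(1/δ) ε⁻²⌉`. -/
def configOf (d : ℕ) (A B C : ℝ) (T : ℕ) : Config where
  P := C + A * B
  eps := epsOf T
  mu := epsOf T * ((C + A * B) *
    √(d * Real.log ((1 + B ^ 2 * T) / deltaOf (C + A * B) T)) + A)⁻¹
  Tint := ⌈8 * (C + A * B) ^ 2 * Real.log (1 / deltaOf (C + A * B) T) * (epsOf T ^ 2)⁻¹⌉₊
  TFD := ⌈2 * Real.log (1 / deltaOf (C + A * B) T) * (epsOf T ^ 2)⁻¹⌉₊

/-! ## The probabilistic model -/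

/-- The random elements of the model: uniform draws `U t` on `[-P, P]` of the learner, noise
`ξs t ∼ νs` of the sellers and `ξb t ∼ νb` of the buyers, all of them mutually independent. -/
structure IsModel {Ω : Type*} [MeasurableSpace Ω] (μ : Measure Ω) (P : ℝ) (νs νb : Measure ℝ)
    (U ξs ξb : ℕ → Ω → ℝ) : Prop where
  measurable_U : ∀ t, Measurable (U t)
  measurable_s : ∀ t, Measurable (ξs t)
  measurable_b : ∀ t, Measurable (ξb t)
  law_U : ∀ t, pdf.IsUniform (U t) (Set.Icc (-P) P) μ
  law_s : ∀ t, μ.map (ξs t) = νs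
  law_b : ∀ t, μ.map (ξb t) = νb
  indep : iIndepFun (Sum.elim U (Sum.elim ξs ξb)) μ

end BilateralTrade

end

noncomputable section

namespace BilateralTrade

variable {d : ℕ}

/-! ### The schedule of the phases -/

/-! The regret splits into exploration rounds, each costing at most `4P`, and commit rounds, each
costing `O(ε)` on an event of probability at least `1 - 1/T` (`regret_le_of_goodRun`).

Counting exploration rounds is deterministic. Parameter rounds are bounded by the elliptical
potential argument (`card_estPar_le`): each multiplies the determinant of the Gram matrix by more
than `1 + μ²`, while that determinant is polynomial in `T`. All other kinds have quotas. The
dominant terms are `ε⁻³ log T` and `ε⁻² (log T)²`, and `ε⁻³ ≤ T^{3/4}`.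

The probabilistic part rests on `phaseAt_congr`: with contexts fixed in advance, the kind of every
round is determined before any randomness is drawn. Hence every sample set is a deterministic set of
indices, and Hoeffding's inequality with a union bound suffices (`measure_not_goodSide_le`), without
martingales. The buyer is a seller after negating prices and valuations, so concentration is proved
for one agent only.

The posted prices and the integral estimates do depend on data, through the parameter estimates.
This dependence is removed by monotonicity: a parameter error of `4ε` places each observed bit
between two indicators with fixed thresholds `(m ± 4)ε` that involve only fresh noise and fresh
uniform draws (`abs_avg_sub_cdfAt_le`, `abs_avg_sub_clippedSurplus_le`).

At a single price the expected gain from trade is `F(u) I(w) + G(w) J(u)`, where `F`, `G` are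
acceptance probabilities, `I`, `J` are expected surpluses and `u`, `w` are the margins of the price.
Uniform prices stop at `P`, so the algorithm does not estimate `J` and `I` but averages of truncated
versions, which are wrong at large margins. The key point is `tradeValue_sub_le`: a near maximizer
of the truncated objective is a near maximizer of the true one. Between `b - C` and `a + C` the two
objectives agree or the true one is constant; outside, the true loss is at most a constant times the
truncated loss. -/

/-- The rounds before `t` of kind `φ` for the sequence `ψ` of kinds. -/
def roundsOf (ψ : ℕ → Phase) (t : ℕ) (φ : Phase) : Finset ℕ :=
  (Finset.range t).filter (fun l => ψ l = φ)

lemma mem_roundsOf {ψ : ℕ → Phase} {t l : ℕ} {φ : Phase} :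
    l ∈ roundsOf ψ t φ ↔ l < t ∧ ψ l = φ := by
  simp [roundsOf]

lemma roundsOf_succ (ψ : ℕ → Phase) (t : ℕ) (φ : Phase) :
    roundsOf ψ (t + 1) φ =
      if ψ t = φ then insert t (roundsOf ψ t φ) else roundsOf ψ t φ := by
  simp only [roundsOf, Finset.range_add_one, Finset.filter_insert]

lemma notMem_roundsOf_self (ψ : ℕ → Phase) (t : ℕ) (φ : Phase) : t ∉ roundsOf ψ t φ := by
  simp [mem_roundsOf]

lemma roundsOf_mono (ψ : ℕ → Phase) (φ : Phase) {s t : ℕ} (h : s ≤ t) :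
    roundsOf ψ s φ ⊆ roundsOf ψ t φ := fun l hl => by
  rw [mem_roundsOf] at *
  exact ⟨hl.1.trans_le h, hl.2⟩

lemma roundsOf_congr {ψ ψ' : ℕ → Phase} {t : ℕ} (h : ∀ l < t, ψ l = ψ' l) :
    roundsOf ψ t = roundsOf ψ' t := by
  funext φ
  refine Finset.filter_congr fun l hl => ?_
  rw [h l (Finset.mem_range.1 hl)]

lemma card_roundsOf_le {ψ : ℕ → Phase} {φ : Phase} {N : ℕ}
    (h : ∀ t, ψ t = φ → (roundsOf ψ t φ).card < N) (t : ℕ) : (roundsOf ψ t φ).card ≤ N := by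
  induction t with
  | zero => simp [roundsOf]
  | succ t ih =>
    rw [roundsOf_succ]
    split_ifs with hφ
    · rw [Finset.card_insert_of_notMem (notMem_roundsOf_self ψ t φ)]
      exact h t hφ
    · exact ih

/-- The regularized Gram matrix `I + ∑_{l ∈ s} x_l x_lᵀ`. -/
def gram (x : ℕ → EuclideanSpace ℝ (Fin d)) (s : Finset ℕ) : Matrix (Fin d) (Fin d) ℝ :=
  1 + ∑ l ∈ s, Matrix.vecMulVec (x l).ofLp (x l).ofLp

section Run

variable (cfg : Config) (ch : Choice) (x : ℕ → EuclideanSpace ℝ (Fin d)) (u s b : ℕ → ℝ)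

lemma stateAt_succ (t : ℕ) : stateAt cfg ch x u s b (t + 1) =
    (stateAt cfg ch x u s b t).update cfg t
      ⟨x t, priceAt cfg ch x u s b t, decide (s t ≤ priceAt cfg ch x u s b t),
        decide (priceAt cfg ch x u s b t ≤ b t)⟩ (phaseAt cfg ch x u s b t) := rfl

lemma hist_update (S : State d) (t : ℕ) (o : Obs d) (φ : Phase) :
    (S.update cfg t o φ).hist = Function.update S.hist t o := by
  cases φ <;> rfl

lemma hist_stateAt {l t : ℕ} (h : l < t) : (stateAt cfg ch x u s b t).hist l =
    ⟨x l, priceAt cfg ch x u s b l, decide (s l ≤ priceAt cfg ch x u s b l),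
      decide (priceAt cfg ch x u s b l ≤ b l)⟩ := by
  induction t with
  | zero => omega
  | succ t ih =>
    rw [stateAt_succ, hist_update]
    rcases Nat.lt_succ_iff_lt_or_eq.1 h with h | rfl
    · rw [Function.update_of_ne h.ne, ih h]
    · rw [Function.update_self]

lemma Tpar_stateAt (t : ℕ) : (stateAt cfg ch x u s b t).Tpar =
    roundsOf (phaseAt cfg ch x u s b) t .estPar := by
  induction t with
  | zero => rfl
  | succ t ih =>
    rw [roundsOf_succ, ← ih, stateAt_succ]
    cases h : phaseAt cfg ch x u s b t <;> simp [State.update, State.record, State.refreshInt]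

lemma Tint_stateAt (t : ℕ) : (stateAt cfg ch x u s b t).Tint =
    roundsOf (phaseAt cfg ch x u s b) t .estInt := by
  induction t with
  | zero => rfl
  | succ t ih =>
    rw [roundsOf_succ, ← ih, stateAt_succ]
    cases h : phaseAt cfg ch x u s b t <;> simp [State.update, State.record, State.refreshInt]

lemma TF_stateAt (t : ℕ) (k : ℤ) : (stateAt cfg ch x u s b t).TF k =
    roundsOf (phaseAt cfg ch x u s b) t (.estF k) := by
  induction t with
  | zero => rfl
  | succ t ih =>
    rw [roundsOf_succ, ← ih, stateAt_succ]
    cases h : phaseAt cfg ch x u s b t <;>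
      simp [State.update, State.record, State.refreshInt, Function.update_apply]
    grind

lemma TD_stateAt (t : ℕ) (k : ℤ) : (stateAt cfg ch x u s b t).TD k =
    roundsOf (phaseAt cfg ch x u s b) t (.estD k) := by
  induction t with
  | zero => rfl
  | succ t ih =>
    rw [roundsOf_succ, ← ih, stateAt_succ]
    cases h : phaseAt cfg ch x u s b t <;>
      simp [State.update, State.record, State.refreshInt, Function.update_apply]
    grind

lemma V_stateAt (t : ℕ) : (stateAt cfg ch x u s b t).V =
    gram x (roundsOf (phaseAt cfg ch x u s b) t .estPar) := by
  rw [State.V, gram, Tpar_stateAt]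
  congr 1
  refine Finset.sum_congr rfl fun l hl => ?_
  rw [hist_stateAt _ _ _ _ _ _ (mem_roundsOf.1 hl).1]

/-- The estimates of the integrals are those of some earlier time with the same sample. -/
lemma exists_estimates_eq (t : ℕ) (h : (roundsOf (phaseAt cfg ch x u s b) t .estInt).Nonempty) :
    ∃ τ ≤ t, roundsOf (phaseAt cfg ch x u s b) τ .estInt =
        roundsOf (phaseAt cfg ch x u s b) t .estInt ∧
      (stateAt cfg ch x u s b t).Ihat = (stateAt cfg ch x u s b τ).estI cfg ∧
      (stateAt cfg ch x u s b t).Jhat = (stateAt cfg ch x u s b τ).estJ cfg := by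
  induction t with
  | zero => simp [roundsOf] at h
  | succ t ih =>
    by_cases hφ : phaseAt cfg ch x u s b t = .estInt
    · refine ⟨t + 1, le_rfl, rfl, ?_, ?_⟩ <;> rw [stateAt_succ, hφ] <;> rfl
    · rw [roundsOf_succ, if_neg hφ] at h ⊢
      obtain ⟨τ, hτ, h₁, h₂, h₃⟩ := ih h
      refine ⟨τ, by omega, h₁, ?_⟩
      rw [← h₂, ← h₃, stateAt_succ]
      cases hφ' : phaseAt cfg ch x u s b t <;> first | exact absurd hφ' hφ | exact ⟨rfl, rfl⟩

/-- The kinds of rounds do not depend on the random elements. -/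
lemma phaseAt_congr (u' s' b' : ℕ → ℝ) :
    phaseAt cfg ch x u s b = phaseAt cfg ch x u' s' b' := by
  funext t
  induction t using Nat.strong_induction_on with
  | _ t ih =>
    -- The kind of a round is read off the context, the Gram matrix and the sizes of the sample
    -- sets, all of which are functions of the earlier kinds; prices and bits enter only the
    -- estimates.
    have hr := roundsOf_congr ih
    have hu : (stateAt cfg ch x u s b t).unfinished cfg =
        (stateAt cfg ch x u' s' b' t).unfinished cfg := by
      simp only [State.unfinished, TF_stateAt, TD_stateAt, hr]
    rw [phaseAt, phaseAt, State.phase, State.phase, hu]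
    simp only [V_stateAt, Tint_stateAt, TF_stateAt, hr]

variable {cfg ch x u s b} {t : ℕ}

lemma mu_lt_of_phaseAt (h : phaseAt cfg ch x u s b t = .estPar) : cfg.mu <
    matNorm (gram x (roundsOf (phaseAt cfg ch x u s b) t .estPar))⁻¹ (x t) := by
  rw [phaseAt, State.phase, V_stateAt] at h
  split_ifs at h with h₁
  exact h₁

lemma le_mu_of_phaseAt (h : phaseAt cfg ch x u s b t ≠ .estPar) :
    matNorm (gram x (roundsOf (phaseAt cfg ch x u s b) t .estPar))⁻¹ (x t) ≤ cfg.mu := by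
  by_contra! h₁
  refine h ?_
  rw [phaseAt, State.phase, V_stateAt, if_pos h₁]

lemma card_lt_of_phaseAt_estInt (h : phaseAt cfg ch x u s b t = .estInt) :
    (roundsOf (phaseAt cfg ch x u s b) t .estInt).card < cfg.Tint := by
  rw [phaseAt, State.phase, Tint_stateAt] at h
  split_ifs at h with _ h₁
  exact h₁

lemma mem_unfinished {S : State d} {k : ℤ} : k ∈ S.unfinished cfg ↔
    k ∈ cfg.grid ∧ ((S.TF k).card < cfg.TFD ∨ (S.TD k).card < cfg.TFD) := by
  simp [State.unfinished]

lemma card_lt_of_phaseAt_estF {k : ℤ} (h : phaseAt cfg ch x u s b t = .estF k) :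
    k ∈ cfg.grid ∧ (roundsOf (phaseAt cfg ch x u s b) t (.estF k)).card < cfg.TFD := by
  rw [phaseAt, State.phase] at h
  split_ifs at h with _ _ h₁ h₂
  rw [Phase.estF.injEq] at h
  have h₃ := ch.pick_mem t _ h₁
  rw [h] at h₂ h₃
  rw [TF_stateAt] at h₂
  exact ⟨(mem_unfinished.1 h₃).1, h₂⟩

lemma card_lt_of_phaseAt_estD {k : ℤ} (h : phaseAt cfg ch x u s b t = .estD k) :
    k ∈ cfg.grid ∧ (roundsOf (phaseAt cfg ch x u s b) t (.estD k)).card < cfg.TFD := by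
  rw [phaseAt, State.phase] at h
  split_ifs at h with _ _ h₁ h₂
  rw [Phase.estD.injEq] at h
  have h₃ := ch.pick_mem t _ h₁
  rw [h] at h₂ h₃
  rw [← TD_stateAt]
  exact ⟨(mem_unfinished.1 h₃).1, (mem_unfinished.1 h₃).2.resolve_left h₂⟩

lemma le_card_of_phaseAt_commit (h : phaseAt cfg ch x u s b t = .commit) :
    cfg.Tint ≤ (roundsOf (phaseAt cfg ch x u s b) t .estInt).card ∧ ∀ k ∈ cfg.grid,
      cfg.TFD ≤ (roundsOf (phaseAt cfg ch x u s b) t (.estF k)).card ∧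
      cfg.TFD ≤ (roundsOf (phaseAt cfg ch x u s b) t (.estD k)).card := by
  rw [phaseAt, State.phase] at h
  split_ifs at h with _ h₁ h₂
  rw [Tint_stateAt] at h₁
  refine ⟨not_lt.1 h₁, fun k hk => ?_⟩
  by_contra h₃
  refine h₂ ⟨k, mem_unfinished.2 ⟨hk, ?_⟩⟩
  rw [TF_stateAt, TD_stateAt]
  omega

/-- Every kind other than `estPar` occurs only while its quota is unfilled, so only the parameter
rounds need a geometric argument. -/
lemma explorationRounds_le (T : ℕ) : explorationRounds cfg ch x u s b T ≤
    (roundsOf (phaseAt cfg ch x u s b) T .estPar).card + cfg.Tint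
      + 2 * (2 * cfg.K + 1) * cfg.TFD := by
  classical
  set ψ := phaseAt cfg ch x u s b with hψ
  have hsub : (Finset.range T).filter (fun t => ψ t ≠ Phase.commit) ⊆
      (roundsOf ψ T .estPar ∪ roundsOf ψ T .estInt) ∪
        cfg.grid.biUnion (fun k => roundsOf ψ T (.estF k) ∪ roundsOf ψ T (.estD k)) := by
    intro t ht
    simp only [Finset.mem_filter, Finset.mem_range] at ht
    simp only [Finset.mem_union, Finset.mem_biUnion, mem_roundsOf]
    cases h : ψ t with
    | estPar => exact .inl (.inl ⟨ht.1, rfl⟩)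
    | estInt => exact .inl (.inr ⟨ht.1, rfl⟩)
    | estF k => exact .inr ⟨k, (card_lt_of_phaseAt_estF h).1, .inl ⟨ht.1, rfl⟩⟩
    | estD k => exact .inr ⟨k, (card_lt_of_phaseAt_estD h).1, .inr ⟨ht.1, rfl⟩⟩
    | commit => exact absurd h ht.2
  have hgrid : cfg.grid.card = 2 * cfg.K + 1 := by
    rw [Config.grid, Int.card_Icc]
    omega
  have h₁ : (roundsOf ψ T .estInt).card ≤ cfg.Tint :=
    card_roundsOf_le (fun t h => card_lt_of_phaseAt_estInt h) T
  have h₂ : (cfg.grid.biUnion (fun k => roundsOf ψ T (.estF k) ∪ roundsOf ψ T (.estD k))).card ≤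
      cfg.grid.card * (cfg.TFD + cfg.TFD) :=
    Finset.card_biUnion_le_card_mul _ _ _ fun k _ => (Finset.card_union_le _ _).trans <|
      add_le_add (card_roundsOf_le (fun t h => (card_lt_of_phaseAt_estF h).2) T)
        (card_roundsOf_le (fun t h => (card_lt_of_phaseAt_estD h).2) T)
  rw [explorationRounds, ← hψ]
  calc _ ≤ _ := Finset.card_le_card hsub
    _ ≤ _ := Finset.card_union_le _ _
    _ ≤ _ := add_le_add (Finset.card_union_le _ _) h₂
    _ ≤ _ := by rw [hgrid]; nlinarith

end Run

/-! ### The Gram matrix -/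

section Gram

variable (x : ℕ → EuclideanSpace ℝ (Fin d)) (s : Finset ℕ)

lemma inner_eq_dotProduct (a c : EuclideanSpace ℝ (Fin d)) : ⟪a, c⟫ = a.ofLp ⬝ᵥ c.ofLp := by
  rw [EuclideanSpace.inner_eq_star_dotProduct, star_trivial, dotProduct_comm]

lemma gram_posDef : (gram x s).PosDef := by
  refine Matrix.PosDef.add_posSemidef Matrix.PosDef.one (Matrix.posSemidef_sum _ fun l _ => ?_)
  simpa using Matrix.posSemidef_vecMulVec_self_star (x l).ofLp

lemma gram_mulVec (y : Fin d → ℝ) :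
    (gram x s).mulVec y = y + ∑ l ∈ s, ((x l).ofLp ⬝ᵥ y) • (x l).ofLp := by
  rw [gram, Matrix.add_mulVec, Matrix.one_mulVec, Matrix.sum_mulVec]
  congr 1
  refine Finset.sum_congr rfl fun l _ => ?_
  rw [Matrix.vecMulVec_mulVec, op_smul_eq_smul]

lemma dotProduct_gram_mulVec (z y : Fin d → ℝ) : z ⬝ᵥ (gram x s).mulVec y =
    z ⬝ᵥ y + ∑ l ∈ s, (z ⬝ᵥ (x l).ofLp) * (y ⬝ᵥ (x l).ofLp) := by
  rw [gram_mulVec, dotProduct_add, dotProduct_sum]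
  congr 1
  refine Finset.sum_congr rfl fun l _ => ?_
  rw [dotProduct_smul, smul_eq_mul, mul_comm, dotProduct_comm y]

/-- The vector `V⁻¹ a`. -/
def dualVec (a : EuclideanSpace ℝ (Fin d)) : Fin d → ℝ := (gram x s)⁻¹.mulVec a.ofLp

lemma gram_mulVec_dualVec (a : EuclideanSpace ℝ (Fin d)) :
    (gram x s).mulVec (dualVec x s a) = a.ofLp := by
  rw [dualVec, Matrix.mulVec_mulVec, Matrix.mul_nonsing_inv, Matrix.one_mulVec]
  exact (gram_posDef x s).det_pos.ne'.isUnit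

lemma dotProduct_inv_mulVec (a : EuclideanSpace ℝ (Fin d)) (w : Fin d → ℝ) :
    a.ofLp ⬝ᵥ (gram x s)⁻¹.mulVec w = dualVec x s a ⬝ᵥ w := by
  have h : ((gram x s)⁻¹).transpose = (gram x s)⁻¹ := by
    simpa [Matrix.IsHermitian] using (gram_posDef x s).isHermitian.inv
  rw [dualVec, Matrix.dotProduct_mulVec, ← Matrix.mulVec_transpose, h]

lemma dotProduct_dualVec (a : EuclideanSpace ℝ (Fin d)) : a.ofLp ⬝ᵥ dualVec x s a =
    dualVec x s a ⬝ᵥ dualVec x s a + ∑ l ∈ s, (dualVec x s a ⬝ᵥ (x l).ofLp) ^ 2 := by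
  conv_lhs => rw [dotProduct_comm, ← gram_mulVec_dualVec x s a, dotProduct_gram_mulVec]
  simp only [sq]

lemma zero_le_dotProduct_self (y : Fin d → ℝ) : 0 ≤ y ⬝ᵥ y :=
  Finset.sum_nonneg fun _ _ => mul_self_nonneg _

lemma dotProduct_dualVec_nonneg (a : EuclideanSpace ℝ (Fin d)) :
    0 ≤ a.ofLp ⬝ᵥ dualVec x s a := by
  rw [dotProduct_dualVec]
  exact add_nonneg (zero_le_dotProduct_self _) (Finset.sum_nonneg fun _ _ => sq_nonneg _)

lemma matNorm_sq (a : EuclideanSpace ℝ (Fin d)) :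
    matNorm (gram x s)⁻¹ a ^ 2 = a.ofLp ⬝ᵥ dualVec x s a :=
  Real.sq_sqrt (dotProduct_dualVec_nonneg x s a)

lemma matNorm_nonneg (M : Matrix (Fin d) (Fin d) ℝ) (a : EuclideanSpace ℝ (Fin d)) :
    0 ≤ matNorm M a := Real.sqrt_nonneg _

/-- More data can only shrink the confidence width. With `y = V'⁻¹a` and `z = V⁻¹a`, expanding `(y -
z)ᵀV(y - z) ≥ 0` and using `yᵀVy ≤ yᵀV'y = yᵀa` leaves `zᵀa - yᵀa ≥ 0`. -/
lemma matNorm_gram_anti {s s' : Finset ℕ} (h : s ⊆ s') (a : EuclideanSpace ℝ (Fin d)) :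
    matNorm (gram x s')⁻¹ a ≤ matNorm (gram x s)⁻¹ a := by
  refine Real.sqrt_le_sqrt ?_
  change a.ofLp ⬝ᵥ dualVec x s' a ≤ a.ofLp ⬝ᵥ dualVec x s a
  set y := dualVec x s' a with hy
  set z := dualVec x s a with hz
  have h₁ : 0 ≤ (y - z) ⬝ᵥ (gram x s).mulVec (y - z) := by
    rw [dotProduct_gram_mulVec]
    exact add_nonneg (zero_le_dotProduct_self _) (Finset.sum_nonneg fun _ _ => mul_self_nonneg _)
  have h₂ : y ⬝ᵥ (gram x s).mulVec y ≤ y ⬝ᵥ a.ofLp := by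
    rw [← gram_mulVec_dualVec x s' a, dotProduct_gram_mulVec, dotProduct_gram_mulVec]
    exact add_le_add_right (Finset.sum_le_sum_of_subset_of_nonneg h
      fun _ _ _ => mul_self_nonneg _) _
  have h₃ : z ⬝ᵥ (gram x s).mulVec y = y ⬝ᵥ a.ofLp := by
    rw [← gram_mulVec_dualVec x s a, ← hz, dotProduct_gram_mulVec, dotProduct_gram_mulVec,
      dotProduct_comm]
    simp only [mul_comm]
  rw [Matrix.mulVec_sub, gram_mulVec_dualVec, dotProduct_sub, sub_dotProduct, sub_dotProduct,
    h₃] at h₁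
  rw [dotProduct_comm _ y, dotProduct_comm _ z]
  linarith

/-- The weights `⟨V⁻¹ a, x_l⟩` of a linear prediction at `a`. -/
def weight (a : EuclideanSpace ℝ (Fin d)) (l : ℕ) : ℝ := dualVec x s a ⬝ᵥ (x l).ofLp

/-- The variance proxy of a ridge prediction at `a`: `aᵀV⁻¹a` is this sum plus the regularization
term `‖V⁻¹a‖²`, which is dropped. -/
lemma sum_weight_sq_le (a : EuclideanSpace ℝ (Fin d)) :
    ∑ l ∈ s, weight x s a l ^ 2 ≤ matNorm (gram x s)⁻¹ a ^ 2 := by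
  rw [matNorm_sq, dotProduct_dualVec]
  exact le_add_of_nonneg_left (zero_le_dotProduct_self _)

/-- The bias of ridge regression. Since `V` is the identity plus the sum of the `x_l x_lᵀ`, the
difference equals `-⟪V⁻¹a, θ⟫`, and `‖V⁻¹a‖² ≤ aᵀV⁻¹a`. -/
lemma abs_sum_weight_mul_inner_sub_le (a θ : EuclideanSpace ℝ (Fin d)) :
    |∑ l ∈ s, weight x s a l * ⟪x l, θ⟫ - ⟪a, θ⟫| ≤ matNorm (gram x s)⁻¹ a * ‖θ‖ := by
  set y : EuclideanSpace ℝ (Fin d) := WithLp.toLp 2 (dualVec x s a) with hy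
  have h₁ : ∑ l ∈ s, weight x s a l * ⟪x l, θ⟫ - ⟪a, θ⟫ = -⟪y, θ⟫ := by
    have h : θ.ofLp ⬝ᵥ (gram x s).mulVec (dualVec x s a) = θ.ofLp ⬝ᵥ a.ofLp := by
      rw [gram_mulVec_dualVec]
    rw [dotProduct_gram_mulVec] at h
    simp only [inner_eq_dotProduct, weight, hy]
    rw [dotProduct_comm a.ofLp, ← h, dotProduct_comm (dualVec x s a) θ.ofLp, sub_eq_iff_eq_add,
      neg_add_cancel_left]
    exact Finset.sum_congr rfl fun l _ => by rw [mul_comm, dotProduct_comm θ.ofLp]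
  have h₂ : ‖y‖ ≤ matNorm (gram x s)⁻¹ a := by
    refine le_of_sq_le_sq ?_ (matNorm_nonneg _ _)
    rw [matNorm_sq, dotProduct_dualVec, ← real_inner_self_eq_norm_sq, inner_eq_dotProduct]
    exact le_add_of_nonneg_right (Finset.sum_nonneg fun _ _ => sq_nonneg _)
  rw [h₁, abs_neg]
  exact (abs_real_inner_le_norm y θ).trans (by gcongr)

lemma inner_toLp_smul_inv_mulVec (c : ℝ) (f : ℕ → ℝ) (a : EuclideanSpace ℝ (Fin d)) :
    ⟪a, WithLp.toLp 2 (c • (gram x s)⁻¹.mulVec (∑ l ∈ s, f l • (x l).ofLp))⟫ =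
      c * ∑ l ∈ s, weight x s a l * f l := by
  rw [inner_eq_dotProduct, dotProduct_smul, dotProduct_inv_mulVec, dotProduct_sum, smul_eq_mul]
  congr 1
  refine Finset.sum_congr rfl fun l _ => ?_
  rw [dotProduct_smul, smul_eq_mul, mul_comm, weight]

lemma det_gram_insert {t : ℕ} (ht : t ∉ s) : (gram x (insert t s)).det =
    (gram x s).det * (1 + matNorm (gram x s)⁻¹ (x t) ^ 2) := by
  have h : gram x (insert t s) = gram x s +
      Matrix.replicateCol Unit (x t).ofLp * Matrix.replicateRow Unit (x t).ofLp := by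
    rw [gram, gram, Finset.sum_insert ht, ← Matrix.vecMulVec_eq]
    abel
  rw [h, Matrix.det_add_replicateCol_mul_replicateRow (gram_posDef x s).det_pos.ne'.isUnit,
    matNorm_sq, Matrix.det_unique (n := Unit)]
  congr 1
  simp [Matrix.mul_assoc, Matrix.mul_apply, dotProduct, Matrix.mulVec, dualVec]

lemma trace_gram : (gram x s).trace = d + ∑ l ∈ s, ‖x l‖ ^ 2 := by
  rw [gram, Matrix.trace_add, Matrix.trace_one, Fintype.card_fin, Matrix.trace_sum]
  congr 1
  refine Finset.sum_congr rfl fun l _ => ?_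
  rw [Matrix.trace_vecMulVec, ← inner_eq_dotProduct, real_inner_self_eq_norm_sq]

/-- Each eigenvalue is at most the sum of all of them. This is cruder than the inequality of the
means, but only the logarithm matters. -/
lemma det_gram_le : (gram x s).det ≤ (gram x s).trace ^ d := by
  have h := (gram_posDef x s).posSemidef
  have h₁ := h.isHermitian.det_eq_prod_eigenvalues
  have h₂ := h.isHermitian.trace_eq_sum_eigenvalues
  simp only [RCLike.ofReal_real_eq_id, id_eq] at h₁ h₂
  rw [h₁, h₂]
  calc _ ≤ ∏ _i : Fin d, ∑ j, h.isHermitian.eigenvalues j :=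
        Finset.prod_le_prod (fun i _ => h.eigenvalues_nonneg i) fun i _ =>
          Finset.single_le_sum (fun j _ => h.eigenvalues_nonneg j) (Finset.mem_univ i)
    _ = _ := by simp

end Gram

/-- Elliptical potential: rounds in which the norm of the context exceeds `m`. -/
lemma pow_card_le_det {x : ℕ → EuclideanSpace ℝ (Fin d)} {ψ : ℕ → Phase} {m : ℝ} (hm : 0 ≤ m)
    (h : ∀ t, ψ t = .estPar → m < matNorm (gram x (roundsOf ψ t .estPar))⁻¹ (x t)) (T : ℕ) :
    (1 + m ^ 2) ^ (roundsOf ψ T .estPar).card ≤ (gram x (roundsOf ψ T .estPar)).det := by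
  induction T with
  | zero => simp [roundsOf, gram]
  | succ t ih =>
    rw [roundsOf_succ]
    split_ifs with hφ
    · rw [Finset.card_insert_of_notMem (notMem_roundsOf_self _ _ _),
        det_gram_insert _ _ (notMem_roundsOf_self _ _ _), pow_succ]
      have := (h t hφ).le
      have := (gram_posDef x (roundsOf ψ t .estPar)).det_pos.le
      gcongr
    · exact ih

/-- The determinant is at least `(1 + m²)ⁿ` and at most `(trace)ᵈ`; logarithms are compared using
`log (1 + m²) ≥ (1 + m⁻²)⁻¹`. -/
lemma card_estPar_le {x : ℕ → EuclideanSpace ℝ (Fin d)} {ψ : ℕ → Phase} {m B : ℝ} (hm : 0 < m)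
    (hx : ∀ t, ‖x t‖ ≤ B)
    (h : ∀ t, ψ t = .estPar → m < matNorm (gram x (roundsOf ψ t .estPar))⁻¹ (x t)) (T : ℕ) :
    ((roundsOf ψ T .estPar).card : ℝ) ≤ (1 + (m ^ 2)⁻¹) * (d * Real.log (d + B ^ 2 * T)) := by
  set n := (roundsOf ψ T .estPar).card with hn
  have hnT : n ≤ T := (Finset.card_filter_le _ _).trans_eq (Finset.card_range T)
  have htr : (gram x (roundsOf ψ T .estPar)).trace ≤ d + B ^ 2 * T := by
    rw [trace_gram]
    gcongr
    calc _ ≤ ∑ _l ∈ roundsOf ψ T .estPar, B ^ 2 :=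
          Finset.sum_le_sum fun l _ => by have := hx l; gcongr
      _ = n * B ^ 2 := by rw [Finset.sum_const, nsmul_eq_mul]
      _ ≤ T * B ^ 2 := by gcongr
      _ = _ := mul_comm _ _
  have htr₀ : 0 ≤ (gram x (roundsOf ψ T .estPar)).trace :=
    (gram_posDef _ _).posSemidef.trace_nonneg
  have h₁ : (1 + m ^ 2) ^ n ≤ (d + B ^ 2 * T) ^ d :=
    (pow_card_le_det hm.le h T).trans <| (det_gram_le _ _).trans <| by gcongr
  have h₂ := Real.log_le_log (by positivity) h₁
  rw [Real.log_pow, Real.log_pow] at h₂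
  have h₃ : (1 + (m ^ 2)⁻¹)⁻¹ ≤ Real.log (1 + m ^ 2) := by
    refine le_trans (le_of_eq ?_) (Real.one_sub_inv_le_log_of_pos (by positivity))
    field_simp
    ring
  rw [← inv_mul_le_iff₀ (by positivity), mul_comm]
  exact (mul_le_mul_of_nonneg_left h₃ (Nat.cast_nonneg n)).trans h₂

/-! ### Noise laws -/

/-- Cumulative distribution function. -/
def cdfAt (ν : Measure ℝ) (u : ℝ) : ℝ := ν.real (Set.Iic u)

/-- Expected surplus `E (u - ξ)⁺`. -/
def surplus (ν : Measure ℝ) (u : ℝ) : ℝ := ∫ z, max (u - z) 0 ∂ν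

namespace IsNoiseLaw

variable {C L : ℝ} {ν : Measure ℝ}

lemma ae_mem (h : IsNoiseLaw C L ν) : ∀ᵐ z ∂ν, z ∈ Set.Icc (-C) C := h.support

lemma L_nonneg (h : IsNoiseLaw C L ν) : 0 ≤ L := by
  obtain ⟨f, -, hf, -⟩ := h.density
  exact (hf 0).1.trans (hf 0).2

lemma absolutelyContinuous (h : IsNoiseLaw C L ν) : ν ≪ volume := by
  obtain ⟨f, -, -, hf⟩ := h.density
  rw [hf]
  exact withDensity_absolutelyContinuous _ _

/-- If `C ≤ 0` the law would be carried by `{0}`, which is impossible for a law with a density. -/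
lemma C_pos (h : IsNoiseLaw C L ν) : 0 < C := by
  by_contra! hC
  have := h.isProb
  have h₀ : ν {0} = 0 := h.absolutelyContinuous (by simp)
  have h₁ : ∀ᵐ z ∂ν, z ∉ ({0} : Set ℝ) := measure_eq_zero_iff_ae_notMem.1 h₀
  obtain ⟨z, hz, hz'⟩ := (h.ae_mem.and h₁).exists
  exact hz' (le_antisymm (by linarith [hz.2]) (by linarith [hz.1]))

lemma measure_Ioc_le (h : IsNoiseLaw C L ν) {u v : ℝ} (huv : u ≤ v) :
    ν.real (Set.Ioc u v) ≤ L * (v - u) := by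
  obtain ⟨f, -, hf, hν⟩ := h.density
  have h₁ : ν (Set.Ioc u v) ≤ ENNReal.ofReal (L * (v - u)) := by
    rw [hν, withDensity_apply _ measurableSet_Ioc]
    calc _ ≤ ∫⁻ _ in Set.Ioc u v, ENNReal.ofReal L :=
          lintegral_mono fun z => ENNReal.ofReal_le_ofReal (hf z).2
      _ = _ := by
        rw [setLIntegral_const, Real.volume_Ioc, ENNReal.ofReal_mul h.L_nonneg]
  exact ENNReal.toReal_le_of_le_ofReal (mul_nonneg h.L_nonneg (sub_nonneg.2 huv)) h₁

/-- This is what allows the buyer to be treated as a seller. -/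
lemma map_neg (h : IsNoiseLaw C L ν) : IsNoiseLaw C L (ν.map Neg.neg) := by
  have := h.isProb
  refine ⟨Measure.isProbabilityMeasure_map measurable_neg.aemeasurable, ?_, ?_, ?_⟩
  · rw [Measure.map_apply measurable_neg measurableSet_Icc.compl, Set.preimage_compl]
    simpa using h.support
  · rw [integral_map measurable_neg.aemeasurable (by fun_prop), integral_neg, h.centered, neg_zero]
  · obtain ⟨f, hf, hf', hν⟩ := h.density
    refine ⟨fun u => f (-u), hf.comp measurable_neg, fun u => hf' _, ?_⟩
    ext s hs
    rw [Measure.map_apply measurable_neg hs, hν, withDensity_apply _ (measurable_neg hs),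
      withDensity_apply _ hs]
    have := (Measure.measurePreserving_neg (volume : Measure ℝ)).setLIntegral_comp_preimage hs
      (f := fun u => ENNReal.ofReal (f (-u))) (by fun_prop)
    simpa using this

lemma integrable_of_bounded (h : IsNoiseLaw C L ν) {f : ℝ → ℝ} (hf : Measurable f) {a b : ℝ}
    (hab : ∀ z ∈ Set.Icc (-C) C, f z ∈ Set.Icc a b) : Integrable f ν := by
  have := h.isProb
  exact Integrable.of_mem_Icc a b hf.aemeasurable (h.ae_mem.mono hab)

lemma integrable_id (h : IsNoiseLaw C L ν) : Integrable (fun z => z) ν :=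
  h.integrable_of_bounded measurable_id fun _ hz => hz

lemma integrable_surplus (h : IsNoiseLaw C L ν) (u : ℝ) :
    Integrable (fun z => max (u - z) 0) ν := by
  have := h.isProb
  exact ((integrable_const u).sub h.integrable_id).pos_part

lemma integrable_indicator (h : IsNoiseLaw C L ν) {s : Set ℝ} (hs : MeasurableSet s) :
    Integrable (s.indicator (1 : ℝ → ℝ)) ν := by
  have := h.isProb
  exact (integrable_const (1 : ℝ)).indicator hs

lemma cdfAt_nonneg (ν : Measure ℝ) (u : ℝ) : 0 ≤ cdfAt ν u := measureReal_nonneg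

lemma cdfAt_mono (h : IsNoiseLaw C L ν) : Monotone (cdfAt ν) := fun u v huv => by
  have := h.isProb
  exact measureReal_mono (Set.Iic_subset_Iic.2 huv)

lemma cdfAt_le_one (h : IsNoiseLaw C L ν) (u : ℝ) : cdfAt ν u ≤ 1 := by
  have := h.isProb
  exact measureReal_le_one

lemma cdfAt_eq_one (h : IsNoiseLaw C L ν) {u : ℝ} (hu : C ≤ u) : cdfAt ν u = 1 := by
  have := h.isProb
  rw [cdfAt, measureReal_def, (prob_compl_eq_zero_iff measurableSet_Iic).1, ENNReal.toReal_one]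
  refine measure_mono_null (Set.compl_subset_compl.2 ?_) h.support
  exact fun z hz => hz.2.trans hu

lemma cdfAt_sub_le (h : IsNoiseLaw C L ν) {u v : ℝ} (huv : u ≤ v) :
    cdfAt ν v - cdfAt ν u ≤ L * (v - u) := by
  have := h.isProb
  refine le_trans (le_of_eq ?_) (h.measure_Ioc_le huv)
  rw [cdfAt, cdfAt, ← Set.Iic_sdiff_Iic,
    measureReal_sdiff (Set.Iic_subset_Iic.2 huv) measurableSet_Iic]

lemma surplus_nonneg (ν : Measure ℝ) (u : ℝ) : 0 ≤ surplus ν u :=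
  integral_nonneg fun _ => le_max_right _ _

lemma surplus_eq (h : IsNoiseLaw C L ν) {u : ℝ} (hu : C ≤ u) : surplus ν u = u := by
  have := h.isProb
  have h₁ : surplus ν u = ∫ z, (u - z) ∂ν := by
    refine integral_congr_ae (h.ae_mem.mono fun z hz => ?_)
    exact max_eq_left (by linarith [hz.2])
  rw [h₁, integral_sub (integrable_const u) h.integrable_id, h.centered]
  simp

lemma integral_indicator_mul (ν : Measure ℝ) (u c : ℝ) :
    ∫ z, (Set.Iic u).indicator (1 : ℝ → ℝ) z * c ∂ν = cdfAt ν u * c := by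
  rw [integral_mul_const, integral_indicator_one measurableSet_Iic, cdfAt]

/-- The expected surplus is convex with slope the c.d.f. This inequality and `surplus_sub_le` are
its two slope bounds, obtained by integrating pointwise inequalities for the positive part. -/
lemma le_surplus_sub (h : IsNoiseLaw C L ν) {u v : ℝ} (huv : u ≤ v) :
    cdfAt ν u * (v - u) ≤ surplus ν v - surplus ν u := by
  rw [← integral_indicator_mul, surplus, surplus,
    ← integral_sub (h.integrable_surplus v) (h.integrable_surplus u)]
  refine integral_mono ((h.integrable_indicator measurableSet_Iic).mul_const _)
    ((h.integrable_surplus v).sub (h.integrable_surplus u)) fun z => ?_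
  simp only [Set.indicator_apply, Set.mem_Iic, Pi.one_apply]
  split_ifs with hz
  · rw [max_eq_left (by linarith), max_eq_left (by linarith)]
    linarith
  · rw [max_eq_right (a := u - z) (by linarith)]
    simp

lemma surplus_sub_le (h : IsNoiseLaw C L ν) (u v : ℝ) :
    surplus ν v - surplus ν u ≤ cdfAt ν v * (v - u) := by
  rw [← integral_indicator_mul, surplus, surplus,
    ← integral_sub (h.integrable_surplus v) (h.integrable_surplus u)]
  refine integral_mono ((h.integrable_surplus v).sub (h.integrable_surplus u))
    ((h.integrable_indicator measurableSet_Iic).mul_const _) fun z => ?_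
  simp only [Set.indicator_apply, Set.mem_Iic, Pi.one_apply]
  split_ifs with hz
  · rw [max_eq_left (a := v - z) (by linarith)]
    linarith [le_max_left (u - z) 0]
  · rw [max_eq_right (a := v - z) (by linarith)]
    linarith [le_max_right (u - z) 0]

lemma surplus_mono (h : IsNoiseLaw C L ν) : Monotone (surplus ν) := fun u v huv => by
  have := mul_nonneg (cdfAt_nonneg ν u) (sub_nonneg.2 huv)
  linarith [h.le_surplus_sub huv]

lemma surplus_sub_le_sub (h : IsNoiseLaw C L ν) {u v : ℝ} (huv : u ≤ v) :
    surplus ν v - surplus ν u ≤ v - u :=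
  (h.surplus_sub_le u v).trans <|
    mul_le_of_le_one_left (sub_nonneg.2 huv) (h.cdfAt_le_one v)

end IsNoiseLaw

/-! ### The truncated surplus -/

/-- Average over the contexts in `s`, of seller's mean valuations `a l`, of the expected surplus at
the price `a l + u` truncated at `P`. -/
def clippedSurplus (ν : Measure ℝ) (P : ℝ) (a : ℕ → ℝ) (s : Finset ℕ) (u : ℝ) : ℝ :=
  (∑ l ∈ s, surplus ν (min u (P - a l))) / s.card

/-- Properties of the c.d.f. `F`, the expected surplus `J`, and a truncation `Jt` of it. -/
structure SupplyCurve (C : ℝ) (F J Jt : ℝ → ℝ) : Prop where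
  nonneg : ∀ u, 0 ≤ F u
  mono : Monotone F
  eq_one : ∀ {u}, C ≤ u → F u = 1
  surplus_eq : ∀ {u}, C ≤ u → J u = u
  le_surplus_sub : ∀ {u v}, u ≤ v → F u * (v - u) ≤ J v - J u
  surplus_sub_le : ∀ u v, J v - J u ≤ F v * (v - u)
  clip_eq : ∀ {u}, u ≤ C → Jt u = J u
  le_clip : ∀ {u}, C ≤ u → C ≤ Jt u
  clip_sub_le : ∀ {u v}, u ≤ v → Jt v - Jt u ≤ v - u

section Clipped

variable {C L P : ℝ} {ν : Measure ℝ} {a : ℕ → ℝ} {s : Finset ℕ}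

lemma clippedSurplus_nonneg (u : ℝ) : 0 ≤ clippedSurplus ν P a s u :=
  div_nonneg (Finset.sum_nonneg fun _ _ => IsNoiseLaw.surplus_nonneg _ _) (Nat.cast_nonneg _)

lemma div_card_le (hs : s.Nonempty) {f : ℕ → ℝ} {c : ℝ} (hf : ∀ l ∈ s, f l ≤ c) :
    (∑ l ∈ s, f l) / s.card ≤ c := by
  rw [div_le_iff₀ (by exact_mod_cast hs.card_pos), mul_comm, ← nsmul_eq_mul]
  exact Finset.sum_le_card_nsmul _ _ _ hf

lemma le_div_card (hs : s.Nonempty) {f : ℕ → ℝ} {c : ℝ} (hf : ∀ l ∈ s, c ≤ f l) :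
    c ≤ (∑ l ∈ s, f l) / s.card := by
  rw [le_div_iff₀ (by exact_mod_cast hs.card_pos), mul_comm, ← nsmul_eq_mul]
  exact Finset.card_nsmul_le_sum _ _ _ hf

lemma clippedSurplus_mono (h : IsNoiseLaw C L ν) : Monotone (clippedSurplus ν P a s) :=
  fun u v huv => by
    unfold clippedSurplus
    gcongr
    exact h.surplus_mono (min_le_min_right _ huv)

lemma clippedSurplus_sub_le (h : IsNoiseLaw C L ν) (hs : s.Nonempty) {u v : ℝ} (huv : u ≤ v) :
    clippedSurplus ν P a s v - clippedSurplus ν P a s u ≤ v - u := by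
  rw [clippedSurplus, clippedSurplus, ← sub_div, ← Finset.sum_sub_distrib]
  refine div_card_le hs fun l _ => ?_
  refine (h.surplus_sub_le_sub (min_le_min_right _ huv)).trans ?_
  rcases le_total v (P - a l) with hv | hv
  · rw [min_eq_left hv, min_eq_left (huv.trans hv)]
  · rw [min_eq_right hv, sub_le_sub_iff]
    rcases le_total u (P - a l) with hu | hu
    · rw [min_eq_left hu]
      linarith
    · rw [min_eq_right hu]
      linarith

lemma clippedSurplus_le (h : IsNoiseLaw C L ν) (hs : s.Nonempty) {N : ℝ}
    (ha : ∀ l, C ≤ P - a l ∧ P - a l ≤ N) (u : ℝ) : clippedSurplus ν P a s u ≤ N :=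
  div_card_le hs fun l _ => (h.surplus_mono (min_le_right _ _)).trans <| by
    rw [h.surplus_eq (ha l).1]
    exact (ha l).2

/-- Because `C ≤ P - a l` for every sampled context, the truncation is inactive at margins up to
`C`, which is also where the c.d.f. reaches `1`. -/
lemma supplyCurve (h : IsNoiseLaw C L ν) (hs : s.Nonempty) (ha : ∀ l, C ≤ P - a l) :
    SupplyCurve C (cdfAt ν) (surplus ν) (clippedSurplus ν P a s) where
  nonneg := IsNoiseLaw.cdfAt_nonneg ν
  mono := h.cdfAt_mono
  eq_one := h.cdfAt_eq_one
  surplus_eq := h.surplus_eq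
  le_surplus_sub := h.le_surplus_sub
  surplus_sub_le := h.surplus_sub_le
  clip_eq {u} hu := by
    rw [clippedSurplus, Finset.sum_congr rfl fun l _ => by rw [min_eq_left (hu.trans (ha l))],
      Finset.sum_const, nsmul_eq_mul, mul_div_assoc, mul_div_cancel₀]
    exact_mod_cast hs.card_pos.ne'
  le_clip {u} hu := le_div_card hs fun l _ => by
    rw [h.surplus_eq (le_min hu (ha l))]
    exact le_min hu (ha l)
  clip_sub_le := clippedSurplus_sub_le h hs

end Clipped

/-! ### Harmlessness of the truncation -/

/-- Expected gain from trade at seller's margin `u` and buyer's margin `w`, with `(F, J)` for the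
seller and `(G, I)` for the buyer. -/
def tradeValue (F J G I : ℝ → ℝ) (u w : ℝ) : ℝ := F u * I w + G w * J u

lemma tradeValue_swap (F J G I : ℝ → ℝ) (u w : ℝ) :
    tradeValue F J G I u w = tradeValue G I F J w u := add_comm _ _

section Comparison

variable {C N : ℝ} {F J Jt G I It : ℝ → ℝ}

/-- Lowering a price that the buyer already accepts surely loses seller acceptance. The buyer's
truncated surplus grows by at most `h`, and that gain is paid for by the drop of `J`, which is at
least `F (u₀ - h) * h`. What remains is the lost probability times `It w₀ ≥ C`. -/
lemma clipped_gap_ge (hS : SupplyCurve C F J Jt) (hB : SupplyCurve C G I It)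
    {u₀ w₀ h : ℝ} (hh : 0 ≤ h) (hu : u₀ ≤ C) (hw : C ≤ w₀) :
    C * (F u₀ - F (u₀ - h)) ≤
      tradeValue F Jt G It u₀ w₀ - tradeValue F Jt G It (u₀ - h) (w₀ + h) := by
  have h₁ := hS.le_surplus_sub (sub_le_self u₀ hh)
  have h₂ := hB.clip_sub_le (le_add_of_nonneg_right hh : w₀ ≤ w₀ + h)
  have h₃ := hB.le_clip hw
  have h₄ := hS.mono (sub_le_self u₀ hh)
  have h₅ := hS.nonneg (u₀ - h)
  rw [tradeValue, tradeValue, hB.eq_one hw, hB.eq_one (by linarith : C ≤ w₀ + h),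
    hS.clip_eq hu, hS.clip_eq (by linarith : u₀ - h ≤ C)]
  nlinarith

/-- The counterpart of `clipped_gap_ge` for the true value: here `I w = w`, so the slope bounds on
`J` put the loss between `w₀` and `w₀ + h` times the lost probability. Together the two lemmas give
the ratio `N / C` of true to truncated loss. -/
lemma tradeValue_gap (hS : SupplyCurve C F J Jt) (hB : SupplyCurve C G I It) (hC : 0 ≤ C)
    {u₀ w₀ h : ℝ} (hh : 0 ≤ h) (hw : C ≤ w₀) (hN : w₀ + h ≤ N) :
    0 ≤ tradeValue F J G I u₀ w₀ - tradeValue F J G I (u₀ - h) (w₀ + h) ∧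
      tradeValue F J G I u₀ w₀ - tradeValue F J G I (u₀ - h) (w₀ + h) ≤
        N * (F u₀ - F (u₀ - h)) := by
  have h₁ := hS.le_surplus_sub (sub_le_self u₀ hh)
  have h₂ := hS.surplus_sub_le (u₀ - h) u₀
  have h₃ := hS.mono (sub_le_self u₀ hh)
  rw [tradeValue, tradeValue, hB.eq_one hw, hB.eq_one (by linarith : C ≤ w₀ + h),
    hB.surplus_eq hw, hB.surplus_eq (by linarith : C ≤ w₀ + h)]
  constructor <;> nlinarith

/-- If the clipped value of the price `q` is within `E` of the best one, then its value is within
a multiple of `E` of the best one. The mean valuations are `a` (seller) and `b` (buyer). -/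
lemma tradeValue_sub_le (hS : SupplyCurve C F J Jt) (hB : SupplyCurve C G I It) (hC : 0 < C)
    (hN : 0 ≤ N) {P a b q E : ℝ} (ha : |a| ≤ P - C) (hb : |b| ≤ P - C) (hq₁ : q - a ≤ N) (hq₂ : b - q ≤ N)
    (hE : ∀ p ∈ Set.Icc (-P) P,
      tradeValue F Jt G It (p - a) (b - p) ≤ tradeValue F Jt G It (q - a) (b - q) + E)
    (p : ℝ) :
    tradeValue F J G I (p - a) (b - p) - tradeValue F J G I (q - a) (b - q) ≤
      (1 + N / C) * E := by
  obtain ⟨ha₁, ha₂⟩ := abs_le.1 ha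
  obtain ⟨hb₁, hb₂⟩ := abs_le.1 hb
  set W : ℝ → ℝ := fun p => tradeValue F J G I (p - a) (b - p) with hW
  set S : ℝ → ℝ := fun p => tradeValue F Jt G It (p - a) (b - p) with hSdef
  -- Left of `lo` the buyer accepts surely and the seller's truncation is inactive; right of `hi`
  -- the roles are exchanged. These are the situations of the two gap lemmas.
  set lo := min (b - C) (a + C) with hlo
  set hi := max (b - C) (a + C) with hhi
  have hlohi : lo ≤ hi := min_le_max
  have hlo₁ : lo ≤ b - C := min_le_left _ _
  have hlo₂ : lo ≤ a + C := min_le_right _ _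
  have hhi₁ : b - C ≤ hi := le_max_left _ _
  have hhi₂ : a + C ≤ hi := le_max_right _ _
  have hloP : lo ∈ Set.Icc (-P) P :=
    ⟨le_min (by linarith) (by linarith), hlo₁.trans (by linarith)⟩
  have hhiP : hi ∈ Set.Icc (-P) P :=
    ⟨hhi₁.trans' (by linarith), max_le (by linarith) (by linarith)⟩
  have left_clip : ∀ r ≤ lo, C * (F (lo - a) - F (r - a)) ≤ S lo - S r := fun r hr => by
    have := clipped_gap_ge hS hB (u₀ := lo - a) (w₀ := b - lo) (sub_nonneg.2 hr)
      (by linarith) (by linarith)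
    rwa [show lo - a - (lo - r) = r - a by ring, show b - lo + (lo - r) = b - r by ring] at this
  have right_clip : ∀ r, hi ≤ r → C * (G (b - hi) - G (b - r)) ≤ S hi - S r := fun r hr => by
    have := clipped_gap_ge hB hS (u₀ := b - hi) (w₀ := hi - a) (sub_nonneg.2 hr)
      (by linarith) (by linarith)
    rw [show b - hi - (r - hi) = b - r by ring, show hi - a + (r - hi) = r - a by ring] at this
    simpa only [hSdef, tradeValue_swap F] using this
  have left : ∀ r ≤ lo, 0 ≤ W lo - W r ∧ (b - r ≤ N → W lo - W r ≤ N * (F (lo - a) - F (r - a))) :=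
    fun r hr => by
      have h (N : ℝ) (hN : _) := tradeValue_gap (N := N) hS hB hC.le (u₀ := lo - a) (w₀ := b - lo)
        (sub_nonneg.2 hr) (by linarith) hN
      rw [show lo - a - (lo - r) = r - a by ring, show b - lo + (lo - r) = b - r by ring] at h
      exact ⟨(h _ le_rfl).1, fun hN => (h N hN).2⟩
  have right : ∀ r, hi ≤ r →
      0 ≤ W hi - W r ∧ (r - a ≤ N → W hi - W r ≤ N * (G (b - hi) - G (b - r))) :=
    fun r hr => by
      have h (N : ℝ) (hN : _) := tradeValue_gap (N := N) hB hS hC.le (u₀ := b - hi) (w₀ := hi - a)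
        (sub_nonneg.2 hr) (by linarith) hN
      rw [show b - hi - (r - hi) = b - r by ring, show hi - a + (r - hi) = r - a by ring] at h
      simp only [hW, tradeValue_swap F]
      exact ⟨(h _ le_rfl).1, fun hN => (h N hN).2⟩
  -- the price `q` may be moved into the interval `[lo, hi]`
  obtain ⟨q', hq', hSq, hWq⟩ : ∃ q' ∈ Set.Icc lo hi, 0 ≤ S q' - S q ∧
      C * (W q' - W q) ≤ N * (S q' - S q) := by
    rcases le_total q lo with h | h
    · have h₁ := hS.mono (by linarith : q - a ≤ lo - a)
      have h₂ := left_clip q h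
      have h₃ := (left q h).2 hq₂
      refine ⟨lo, ⟨le_rfl, hlohi⟩, h₂.trans' (mul_nonneg hC.le (sub_nonneg.2 h₁)), ?_⟩
      calc C * (W lo - W q) ≤ C * (N * (F (lo - a) - F (q - a))) := by gcongr
        _ = N * (C * (F (lo - a) - F (q - a))) := by ring
        _ ≤ _ := by gcongr
    rcases le_total hi q with h' | h'
    · have h₁ := hB.mono (by linarith : b - q ≤ b - hi)
      have h₂ := right_clip q h'
      have h₃ := (right q h').2 hq₁
      refine ⟨hi, ⟨hlohi, le_rfl⟩, h₂.trans' (mul_nonneg hC.le (sub_nonneg.2 h₁)), ?_⟩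
      calc C * (W hi - W q) ≤ C * (N * (G (b - hi) - G (b - q))) := by gcongr
        _ = N * (C * (G (b - hi) - G (b - q))) := by ring
        _ ≤ _ := by gcongr
    · exact ⟨q, ⟨h, h'⟩, by simp, by simp⟩
  obtain ⟨p', hp', hWp⟩ : ∃ p' ∈ Set.Icc lo hi, W p ≤ W p' := by
    rcases le_total p lo with h | h
    · exact ⟨lo, ⟨le_rfl, hlohi⟩, sub_nonneg.1 (left p h).1⟩
    rcases le_total hi p with h' | h'
    · exact ⟨hi, ⟨hlohi, le_rfl⟩, sub_nonneg.1 (right p h').1⟩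
    · exact ⟨p, ⟨h, h'⟩, le_rfl⟩
  have hmemP : ∀ r ∈ Set.Icc lo hi, r ∈ Set.Icc (-P) P := fun r hr =>
    ⟨hloP.1.trans hr.1, hr.2.trans hhiP.2⟩
  have hEq : S q' - S q ≤ E := by linarith [hE q' (hmemP q' hq')]
  have hmain : W p' - W q' ≤ E - (S q' - S q) := by
    -- If `a + C ≤ b - C`, both agents accept surely on `[lo, hi]` and the value is the constant `b
    -- - a`. Otherwise both margins are at most `C` there, so truncated and true values coincide.
    rcases le_total (a + C) (b - C) with hab | hab
    · have hconst : ∀ r ∈ Set.Icc lo hi, W r = b - a := fun r hr => by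
        have h₁ : C ≤ r - a := by linarith [hr.1, min_eq_right hab]
        have h₂ : C ≤ b - r := by linarith [hr.2, max_eq_left hab]
        simp only [hW, tradeValue, hS.eq_one h₁, hB.eq_one h₂, hS.surplus_eq h₁, hB.surplus_eq h₂]
        ring
      rw [hconst p' hp', hconst q' hq']
      linarith
    · have hsame : ∀ r ∈ Set.Icc lo hi, S r = W r := fun r hr => by
        have h₁ : r - a ≤ C := by linarith [hr.2, max_eq_right hab]
        have h₂ : b - r ≤ C := by linarith [hr.1, min_eq_left hab]
        simp only [hW, hSdef, tradeValue, hS.clip_eq h₁, hB.clip_eq h₂]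
      rw [← hsame p' hp', ← hsame q' hq']
      linarith [hE p' (hmemP p' hp')]
  have h₁ : W q' - W q ≤ N / C * E := by
    rw [div_mul_eq_mul_div, le_div_iff₀ hC, mul_comm]
    exact hWq.trans (by gcongr)
  change W p - W q ≤ _
  linarith

end Comparison

/-! ### The expected gain from trade -/

section Egft

variable {C L : ℝ} {νs νb : Measure ℝ} (θs θb x : EuclideanSpace ℝ (Fin d))

lemma cdfAt_map_neg (ν : Measure ℝ) (v : ℝ) : cdfAt (ν.map Neg.neg) (-v) = ν.real (Set.Ici v) := by
  rw [cdfAt, map_measureReal_apply measurable_neg measurableSet_Iic]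
  simp

lemma surplus_map_neg (ν : Measure ℝ) (v : ℝ) :
    surplus (ν.map Neg.neg) (-v) = ∫ z, max (z - v) 0 ∂ν := by
  rw [surplus, integral_map measurable_neg.aemeasurable (by fun_prop)]
  exact integral_congr_ae (.of_forall fun z => by ring_nf)

/-- The gain splits at the posted price as `(b - p) + (p - s)`. Each positive part already encodes
the acceptance of its own agent, so both terms factor over the two independent noises. -/
lemma gft_self_eq (a b p : ℝ) (z : ℝ × ℝ) : gft (a + z.1) (b + z.2) p p =
    (Set.Iic (p - a)).indicator 1 z.1 * max (z.2 - (p - b)) 0 +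
      max (p - a - z.1) 0 * (Set.Ici (p - b)).indicator 1 z.2 := by
  simp only [gft, Set.indicator_apply, Set.mem_Iic, Set.mem_Ici, Pi.one_apply]
  by_cases h₁ : z.1 ≤ p - a <;> by_cases h₂ : p - b ≤ z.2
  · rw [if_pos ⟨by linarith, by linarith⟩, if_pos h₁, if_pos h₂, max_eq_left (by linarith),
      max_eq_left (by linarith)]
    ring
  · rw [if_neg (fun h => h₂ (by linarith [h.2])), if_neg h₂, max_eq_right (by linarith)]
    ring
  · rw [if_neg (fun h => h₁ (by linarith [h.1])), if_neg h₁, max_eq_right (a := p - a - z.1)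
      (by linarith)]
    ring
  · rw [if_neg (fun h => h₁ (by linarith [h.1])), if_neg h₁, if_neg h₂]
    ring

lemma integrable_gft_terms (hs : IsNoiseLaw C L νs) (hb : IsNoiseLaw C L νb) (u v : ℝ) :
    Integrable (fun z : ℝ × ℝ => (Set.Iic u).indicator (1 : ℝ → ℝ) z.1 * max (z.2 - v) 0)
        (νs.prod νb) ∧
      Integrable (fun z : ℝ × ℝ => max (u - z.1) 0 * (Set.Ici v).indicator (1 : ℝ → ℝ) z.2)
        (νs.prod νb) := by
  have := hs.isProb
  have := hb.isProb
  have h : Integrable (fun z => max (z - v) 0) νb :=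
    (hb.integrable_id.sub (integrable_const v)).pos_part
  exact ⟨(hs.integrable_indicator measurableSet_Iic).mul_prod h,
    (hs.integrable_surplus u).mul_prod (hb.integrable_indicator measurableSet_Ici)⟩

lemma egft_self_eq (hs : IsNoiseLaw C L νs) (hb : IsNoiseLaw C L νb) (p : ℝ) :
    egft θs θb νs νb x p p = tradeValue (cdfAt νs) (surplus νs) (cdfAt (νb.map Neg.neg))
      (surplus (νb.map Neg.neg)) (p - ⟪x, θs⟫) (⟪x, θb⟫ - p) := by
  have := hs.isProb
  have := hb.isProb
  simp only [egft, gft_self_eq]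
  obtain ⟨h₁, h₂⟩ := integrable_gft_terms hs hb (p - ⟪x, θs⟫) (p - ⟪x, θb⟫)
  rw [integral_add h₁ h₂, integral_prod_mul (fun z => (Set.Iic (p - ⟪x, θs⟫)).indicator 1 z)
    (fun z => max (z - (p - ⟪x, θb⟫)) 0), integral_prod_mul (fun z => max (p - ⟪x, θs⟫ - z) 0)
    (fun z => (Set.Ici (p - ⟪x, θb⟫)).indicator 1 z), integral_indicator_one measurableSet_Iic,
    integral_indicator_one measurableSet_Ici, tradeValue, ← neg_sub p, cdfAt_map_neg,
    surplus_map_neg, cdfAt, surplus, mul_comm (νb.real _)]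

/-- A trade at `p ≤ q` has `s ≤ p ≤ q ≤ b`, hence nonnegative gain, and it still happens when `p` is
posted to both. So the benchmark reduces to single prices. -/
lemma egft_le_egft_self (hs : IsNoiseLaw C L νs) (hb : IsNoiseLaw C L νb) {p q : ℝ} (hpq : p ≤ q) :
    egft θs θb νs νb x p q ≤ egft θs θb νs νb x p p := by
  have hmeas : Measurable fun z : ℝ × ℝ => gft (⟪x, θs⟫ + z.1) (⟪x, θb⟫ + z.2) p q := by
    refine Measurable.ite (MeasurableSet.inter ?_ ?_) (by fun_prop) measurable_const
    · exact measurableSet_le (f := fun z : ℝ × ℝ => ⟪x, θs⟫ + z.1) (by fun_prop) measurable_const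
    · exact measurableSet_le (g := fun z : ℝ × ℝ => ⟪x, θb⟫ + z.2) measurable_const (by fun_prop)
  have hle (z : ℝ × ℝ) : 0 ≤ gft (⟪x, θs⟫ + z.1) (⟪x, θb⟫ + z.2) p q ∧
      gft (⟪x, θs⟫ + z.1) (⟪x, θb⟫ + z.2) p q ≤ gft (⟪x, θs⟫ + z.1) (⟪x, θb⟫ + z.2) p p := by
    unfold gft
    split_ifs with h₁ h₂ h₂
    · exact ⟨by linarith [h₁.1, h₁.2], le_rfl⟩
    · exact absurd ⟨h₁.1, hpq.trans h₁.2⟩ h₂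
    · exact ⟨le_rfl, by linarith [h₂.1, h₂.2]⟩
    · exact ⟨le_rfl, le_rfl⟩
  have hint : Integrable (fun z : ℝ × ℝ => gft (⟪x, θs⟫ + z.1) (⟪x, θb⟫ + z.2) p p)
      (νs.prod νb) := by
    simp only [gft_self_eq]
    obtain ⟨h₁, h₂⟩ := integrable_gft_terms hs hb (p - ⟪x, θs⟫) (p - ⟪x, θb⟫)
    exact h₁.add h₂
  refine integral_mono (hint.mono' hmeas.aestronglyMeasurable (.of_forall fun z => ?_)) hint
    fun z => (hle z).2
  rw [Real.norm_of_nonneg (hle z).1]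
  exact (hle z).2

lemma bestEgft_le (hs : IsNoiseLaw C L νs) (hb : IsNoiseLaw C L νb) {P M : ℝ} (hP : 0 ≤ P)
    (h : ∀ p ∈ Set.Icc (-P) P, egft θs θb νs νb x p p ≤ M) : bestEgft P θs θb νs νb x ≤ M := by
  have h₀ : (0 : ℝ) ∈ Set.Icc (-P) P := ⟨by linarith, hP⟩
  refine csSup_le ⟨_, 0, h₀, 0, h₀, le_rfl, rfl⟩ ?_
  rintro g ⟨p, hp, q, -, hpq, rfl⟩
  exact (egft_le_egft_self θs θb x hs hb hpq).trans (h p hp)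

lemma egft_self_nonneg (hs : IsNoiseLaw C L νs) (hb : IsNoiseLaw C L νb) (p : ℝ) :
    0 ≤ egft θs θb νs νb x p p := by
  rw [egft_self_eq θs θb x hs hb]
  exact add_nonneg (mul_nonneg (IsNoiseLaw.cdfAt_nonneg _ _) (IsNoiseLaw.surplus_nonneg _ _))
    (mul_nonneg (IsNoiseLaw.cdfAt_nonneg _ _) (IsNoiseLaw.surplus_nonneg _ _))

lemma egft_self_le (hs : IsNoiseLaw C L νs) (hb : IsNoiseLaw C L νb) {P p : ℝ}
    (hθs : |⟪x, θs⟫| ≤ P - C) (hθb : |⟪x, θb⟫| ≤ P - C) (hp : p ∈ Set.Icc (-P) P) :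
    egft θs θb νs νb x p p ≤ 4 * P := by
  have hC := hs.C_pos
  have hPC : C ≤ P := by linarith [abs_nonneg ⟪x, θs⟫]
  have key {ν : Measure ℝ} (hν : IsNoiseLaw C L ν) {u : ℝ} (hu : u ≤ 2 * P) :
      surplus ν u ≤ 2 * P := by
    rw [← hν.surplus_eq (by linarith : C ≤ 2 * P)]
    exact hν.surplus_mono hu
  have h₁ := key hs (u := p - ⟪x, θs⟫) (by linarith [neg_le_of_abs_le hθs, hp.2])
  have h₂ := key hb.map_neg (u := ⟪x, θb⟫ - p) (by linarith [le_of_abs_le hθb, hp.1])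
  rw [egft_self_eq θs θb x hs hb, tradeValue]
  have h₃ := mul_le_of_le_one_left (IsNoiseLaw.surplus_nonneg (νb.map Neg.neg) (⟪x, θb⟫ - p))
    (hs.cdfAt_le_one (p - ⟪x, θs⟫))
  have h₄ := mul_le_of_le_one_left (IsNoiseLaw.surplus_nonneg νs (p - ⟪x, θs⟫))
    (hb.map_neg.cdfAt_le_one (⟪x, θb⟫ - p))
  linarith

end Egft

/-! ### Concentration -/

section Concentration

variable {Ω : Type*} [MeasurableSpace Ω] {μ : Measure Ω}

/-- Pairing two families of random variables that are jointly independent. -/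
lemma iIndepFun_prodMk {ι : Type*} {X Y : ι → Ω → ℝ} (hX : ∀ i, Measurable (X i))
    (hY : ∀ i, Measurable (Y i)) (h : iIndepFun (Sum.elim X Y) μ) :
    iIndepFun (fun i ω => (X i ω, Y i ω)) μ := by
  classical
  set π : ι → Set (Set Ω) := fun i => (fun s => (fun ω => (X i ω, Y i ω)) ⁻¹' s) ''
    Set.image2 (· ×ˢ ·) {s : Set ℝ | MeasurableSet s} {t : Set ℝ | MeasurableSet t} with hπ
  refine iIndepSets.iIndep (fun i => (hX i).prodMk (hY i) |>.comap_le) π (fun i => ?_)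
    (fun i => ?_) ?_
  · rw [hπ]
    exact isPiSystem_prod.comap _
  · rw [hπ, ← MeasurableSpace.comap_generateFrom, generateFrom_prod]
  · rw [iIndepSets_iff]
    intro S f hf
    have hf' : ∀ i, ∃ A B : Set ℝ, MeasurableSet A ∧ MeasurableSet B ∧
        (i ∈ S → f i = X i ⁻¹' A ∩ Y i ⁻¹' B) := fun i => by
      by_cases hi : i ∈ S
      · obtain ⟨_, ⟨A, hA, B, hB, rfl⟩, hf⟩ := hf i hi
        exact ⟨A, B, hA, hB, fun _ => hf.symm⟩
      · exact ⟨∅, ∅, .empty, .empty, fun h => absurd h hi⟩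
    choose A B hA hB hAB using hf'
    have key (S₁ S₂ : Finset ι) := (iIndepFun_iff_measure_inter_preimage_eq_mul.1 h)
      (S₁.disjSum S₂) (sets := fun i => Sum.casesOn i A B)
      (fun i _ => by rcases i with i | i <;> [exact hA i; exact hB i])
    -- Allowing different index sets for the two families in `key` gives both the independence
    -- inside one pair and the independence across pairs.
    have hprod (i : ι) : μ (X i ⁻¹' A i ∩ Y i ⁻¹' B i) = μ (X i ⁻¹' A i) * μ (Y i ⁻¹' B i) := by
      simpa [Finset.prod_disjSum, Set.iInter_sum, Set.iInter_or, Set.iInter_and] using key {i} {i}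
    rw [Finset.prod_congr rfl fun i hi => by rw [hAB i hi, hprod i], Finset.prod_mul_distrib]
    have := key S S
    rw [Finset.prod_disjSum] at this
    simp only [Sum.elim_inl, Sum.elim_inr] at this
    rw [← this]
    congr 1
    ext ω
    simp only [Set.mem_iInter, Finset.mem_disjSum]
    constructor
    · rintro hω (i | i) hi
      · have hi : i ∈ S := by simpa using hi
        have := hω i hi
        rw [hAB i hi] at this
        exact this.1
      · have hi : i ∈ S := by simpa using hi
        have := hω i hi
        rw [hAB i hi] at this
        exact this.2
    · intro hω i hi
      rw [hAB i hi]
      exact ⟨hω (.inl i) (by simpa using hi), hω (.inr i) (by simpa using hi)⟩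

/-- Hoeffding's inequality for a weighted sum of independent variables with values in `[0, 1]`. -/
lemma measure_le_abs_weighted_sum_le [IsProbabilityMeasure μ] {X : ℕ → Ω → ℝ}
    (hX : ∀ l, Measurable (X l)) (hind : iIndepFun X μ) (h01 : ∀ l ω, X l ω ∈ Set.Icc 0 1)
    {s : Finset ℕ} {w m : ℕ → ℝ} (hm : ∀ l, ∫ ω, X l ω ∂μ = m l) {r a : ℝ} (hr : 0 < r)
    (ha : (∑ l ∈ s, w l ^ 2) * a ≤ 2 * r ^ 2) :
    μ.real {ω | r ≤ |∑ l ∈ s, w l * (X l ω - m l)|} ≤ 2 * Real.exp (-a) := by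
  set v := ∑ l ∈ s, w l ^ 2 with hv
  -- With zero variance the sub-Gaussian exponent would be a division by zero; then all weights
  -- vanish and the event is empty.
  rcases (Finset.sum_nonneg fun l _ => sq_nonneg (w l) : 0 ≤ v).eq_or_lt with h₀ | hpos
  · have hw : ∀ l ∈ s, w l = 0 := fun l hl => by
      have := (Finset.sum_eq_zero_iff_of_nonneg fun l _ => sq_nonneg (w l)).1 h₀.symm l hl
      exact pow_eq_zero_iff two_ne_zero |>.1 this
    have : {ω | r ≤ |∑ l ∈ s, w l * (X l ω - m l)|} = ∅ := by
      ext ω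
      simp only [Set.mem_ofPred_eq, Set.mem_empty_iff_false, iff_false, not_le]
      rw [Finset.sum_eq_zero fun l hl => by rw [hw l hl, zero_mul], abs_zero]
      exact hr
    rw [this, measureReal_empty]
    positivity
  have key (c : ℝ) (hc : c ^ 2 = 1) :
      μ.real {ω | r ≤ ∑ l ∈ s, c * w l * (X l ω - m l)} ≤ Real.exp (-a) := by
    have hsub (l : ℕ) : HasSubgaussianMGF (fun ω => c * w l * (X l ω - m l))
        (w l ^ 2 / 4).toNNReal μ := by
      have := (hasSubgaussianMGF_of_mem_Icc (μ := μ) (hX l).aemeasurable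
        (.of_forall (h01 l))).const_mul (c * w l)
      rw [hm l] at this
      convert this using 1
      rw [← NNReal.coe_inj, Real.coe_toNNReal _ (by positivity)]
      change _ = (c * w l) ^ 2 * (‖(1 : ℝ) - 0‖ / 2) ^ 2
      rw [mul_pow, hc, sub_zero, norm_one]
      ring
    have hind' : iIndepFun (fun l ω => c * w l * (X l ω - m l)) μ :=
      hind.comp (fun l y => c * w l * (y - m l)) fun l => by fun_prop
    refine (HasSubgaussianMGF.measure_sum_ge_le_of_iIndepFun hind' (s := s)
      (fun l _ => hsub l) hr.le).trans ?_
    rw [Real.exp_le_exp]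
    rw [NNReal.coe_sum, Finset.sum_congr rfl fun l _ => Real.coe_toNNReal (w l ^ 2 / 4)
      (by positivity), ← Finset.sum_div, ← hv, div_le_iff₀ (by positivity)]
    linarith
  have h₁ := key 1 (by norm_num)
  have h₂ := key (-1) (by norm_num)
  refine (measureReal_mono (s₂ := {ω | r ≤ ∑ l ∈ s, 1 * w l * (X l ω - m l)} ∪
    {ω | r ≤ ∑ l ∈ s, -1 * w l * (X l ω - m l)}) ?_).trans
    ((measureReal_union_le _ _).trans (by linarith))
  intro ω hω
  simp only [Set.mem_ofPred_eq, Set.mem_union, one_mul, neg_mul, Finset.sum_neg_distrib] at hω ⊢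
  exact le_abs.1 hω

/-! ### One agent facing uniform prices -/

/-- The random elements that matter for one of the two agents. -/
structure SideModel (μ : Measure Ω) (P : ℝ) (ν : Measure ℝ) (U ξ : ℕ → Ω → ℝ) : Prop where
  measurable_U : ∀ t, Measurable (U t)
  measurable_ξ : ∀ t, Measurable (ξ t)
  law_U : ∀ t, μ.map (U t) = ProbabilityTheory.cond volume (Set.Icc (-P) P)
  law_ξ : ∀ t, μ.map (ξ t) = ν
  indep : iIndepFun (fun t ω => (U t ω, ξ t ω)) μ
  indepFun : ∀ t, IndepFun (U t) (ξ t) μ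

lemma IsModel.seller {P : ℝ} {νs νb : Measure ℝ} {U ξs ξb : ℕ → Ω → ℝ}
    (h : IsModel μ P νs νb U ξs ξb) : SideModel μ P νs U ξs where
  measurable_U := h.measurable_U
  measurable_ξ := h.measurable_s
  law_U := h.law_U
  law_ξ := h.law_s
  indep := by
    refine iIndepFun_prodMk h.measurable_U h.measurable_s ?_
    convert h.indep.precomp (g := Sum.map id Sum.inl)
      (Sum.map_injective.2 ⟨Function.injective_id, Sum.inl_injective⟩) using 1
    ext (i | i) <;> rfl
  indepFun t := h.indep.indepFun (i := .inl t) (j := .inr (.inl t)) (by simp)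

lemma map_neg_cond_Icc (P : ℝ) : (ProbabilityTheory.cond volume (Set.Icc (-P) P)).map Neg.neg =
    ProbabilityTheory.cond volume (Set.Icc (-P) P) := by
  ext A hA
  rw [Measure.map_apply measurable_neg hA, cond_apply measurableSet_Icc,
    cond_apply measurableSet_Icc]
  congr 1
  rw [← (Measure.measurePreserving_neg (volume : Measure ℝ)).measure_preimage
    (measurableSet_Icc.inter hA).nullMeasurableSet, Set.preimage_inter]
  congr 2
  simp

/-- The buyer accepts `p` exactly when a seller of valuation `-b` accepts `-p`. The uniform law on
`[-P, P]` is symmetric, so the negated draws have the same law. -/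
lemma IsModel.buyer {P : ℝ} {νs νb : Measure ℝ} {U ξs ξb : ℕ → Ω → ℝ}
    (h : IsModel μ P νs νb U ξs ξb) :
    SideModel μ P (νb.map Neg.neg) (fun t ω => -U t ω) (fun t ω => -ξb t ω) where
  measurable_U t := (h.measurable_U t).neg
  measurable_ξ t := (h.measurable_b t).neg
  law_U t := by
    have : (fun ω => -U t ω) = Neg.neg ∘ U t := rfl
    rw [this, ← Measure.map_map measurable_neg (h.measurable_U t), h.law_U t, map_neg_cond_Icc]
  law_ξ t := by
    have : (fun ω => -ξb t ω) = Neg.neg ∘ ξb t := rfl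
    rw [this, ← Measure.map_map measurable_neg (h.measurable_b t), h.law_b t]
  indep := by
    refine (iIndepFun_prodMk (X := U) (Y := ξb) h.measurable_U h.measurable_b ?_).comp
      (fun _ z => (-z.1, -z.2)) fun _ => by fun_prop
    convert h.indep.precomp (g := Sum.map id Sum.inr)
      (Sum.map_injective.2 ⟨Function.injective_id, Sum.inr_injective⟩) using 1
    ext (i | i) <;> rfl
  indepFun t := (h.indep.indepFun (i := .inl t) (j := .inr (.inr t)) (by simp)).comp
    measurable_neg measurable_neg

namespace SideModel

variable {P C L : ℝ} {ν : Measure ℝ} {U ξ : ℕ → Ω → ℝ}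

/-- Given the noise, the uniform price falls in the interval from `α` to `β` with probability its
length over `2P`; the almost sure bounds keep that interval inside the support. -/
lemma measure_between [IsProbabilityMeasure μ] (h : SideModel μ P ν U ξ) (hP : 0 < P) {α β : ℝ → ℝ} (hα : Measurable α)
    (hβ : Measurable β) (hαβ : ∀ᵐ z ∂ν, -P ≤ α z ∧ β z ≤ P) (t : ℕ) :
    μ.real {ω | α (ξ t ω) ≤ U t ω ∧ U t ω ≤ β (ξ t ω)} =
      (∫ z, max (β z - α z) 0 ∂ν) / (2 * P) := by
  have hprob : IsProbabilityMeasure ν := by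
    rw [← h.law_ξ t]
    exact Measure.isProbabilityMeasure_map (h.measurable_ξ t).aemeasurable
  set S : Set (ℝ × ℝ) := {z | α z.1 ≤ z.2 ∧ z.2 ≤ β z.1} with hS
  have hSm : MeasurableSet S :=
    (measurableSet_le (hα.comp measurable_fst) measurable_snd).inter
      (measurableSet_le measurable_snd (hβ.comp measurable_fst))
  have hmap := (indepFun_iff_map_prod_eq_prod_map_map (h.measurable_ξ t).aemeasurable
    (h.measurable_U t).aemeasurable).1 (h.indepFun t).symm
  have hset : {ω | α (ξ t ω) ≤ U t ω ∧ U t ω ≤ β (ξ t ω)} =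
      (fun ω => (ξ t ω, U t ω)) ⁻¹' S := rfl
  have hμ : μ {ω | α (ξ t ω) ≤ U t ω ∧ U t ω ≤ β (ξ t ω)} =
      ∫⁻ z, ENNReal.ofReal (max (β z - α z) 0 / (2 * P)) ∂ν := by
    rw [hset, ← Measure.map_apply ((h.measurable_ξ t).prodMk (h.measurable_U t)) hSm, hmap,
      h.law_ξ, Measure.prod_apply hSm, h.law_U]
    refine lintegral_congr_ae (hαβ.mono fun z hz => ?_)
    have hfib : Prod.mk z ⁻¹' S = Set.Icc (α z) (β z) := rfl
    simp only [hfib]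
    rw [cond_apply measurableSet_Icc, Set.inter_eq_self_of_subset_right
      (Set.Icc_subset_Icc hz.1 hz.2), Real.volume_Icc, Real.volume_Icc, mul_comm,
      ← div_eq_mul_inv, show P - -P = 2 * P by ring, ← ENNReal.ofReal_div_of_pos (by positivity)]
    rcases le_total 0 (β z - α z) with h₁ | h₁
    · rw [max_eq_left h₁]
    · rw [max_eq_right h₁, zero_div, ENNReal.ofReal_zero, ENNReal.ofReal_of_nonpos]
      exact div_nonpos_of_nonpos_of_nonneg h₁ (by positivity)
  rw [measureReal_def, hμ, ← integral_div, integral_eq_lintegral_of_nonneg_ae]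
  · exact .of_forall fun z => div_nonneg (le_max_right _ _) (by positivity)
  · exact Measurable.aestronglyMeasurable (by fun_prop)

lemma ae_U_mem (h : SideModel μ P ν U ξ) (t : ℕ) :
    ∀ᵐ ω ∂μ, U t ω ∈ Set.Icc (-P) P := by
  refine ae_of_ae_map (h.measurable_U t).aemeasurable ?_
  rw [h.law_U]
  exact ae_cond_mem measurableSet_Icc

lemma integral_ite {s : Set Ω} (hs : MeasurableSet s) [DecidablePred (· ∈ s)] :
    ∫ ω, (if ω ∈ s then (1 : ℝ) else 0) ∂μ = μ.real s := by
  rw [← integral_indicator_one hs]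
  refine integral_congr_ae (.of_forall fun ω => ?_)
  simp [Set.indicator_apply]

lemma integral_le_noise (h : SideModel μ P ν U ξ) (v : ℝ) (t : ℕ) :
    ∫ ω, (if ξ t ω ≤ v then (1 : ℝ) else 0) ∂μ = cdfAt ν v := by
  have hs : MeasurableSet {ω | ξ t ω ≤ v} := measurableSet_le (h.measurable_ξ t) measurable_const
  rw [cdfAt, ← h.law_ξ t, map_measureReal_apply (h.measurable_ξ t) measurableSet_Iic]
  exact integral_ite hs

lemma measurableSet_between (h : SideModel μ P ν U ξ) (a v : ℝ) (t : ℕ) :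
    MeasurableSet {ω | a + ξ t ω ≤ U t ω ∧ U t ω ≤ v + a} :=
  (measurableSet_le ((h.measurable_ξ t).const_add a) (h.measurable_U t)).inter
    (measurableSet_le (h.measurable_U t) measurable_const)

/-- The origin of the truncation: draws never exceed `P`, so the effective upper end is `min v (P -
a) + a`. -/
lemma integral_between [IsProbabilityMeasure μ] (h : SideModel μ P ν U ξ) (hν : IsNoiseLaw C L ν) {a : ℝ}
    (ha : |a| ≤ P - C) (v : ℝ) (t : ℕ) :
    ∫ ω, (if a + ξ t ω ≤ U t ω ∧ U t ω ≤ v + a then (1 : ℝ) else 0) ∂μ =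
      surplus ν (min v (P - a)) / (2 * P) := by
  obtain ⟨ha₁, ha₂⟩ := abs_le.1 ha
  have hP : 0 < P := by linarith [hν.C_pos]
  refine (integral_ite (h.measurableSet_between a v t)).trans ?_
  have h₁ := h.measure_between hP (α := fun z => a + z) (β := fun _ => min v (P - a) + a)
    (by fun_prop) (by fun_prop) (hν.ae_mem.mono fun z hz =>
      ⟨by linarith [hz.1], by linarith [min_le_right v (P - a)]⟩) t
  rw [surplus]
  simp only [add_sub_add_right_eq_sub, add_comm a, add_sub_add_right_eq_sub] at h₁ ⊢
  rw [← h₁]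
  refine measureReal_congr ?_
  filter_upwards [h.ae_U_mem t] with ω hω
  refine propext (and_congr_right fun _ => ?_)
  rw [← min_add_add_right, sub_add_cancel, le_min_iff]
  exact ⟨fun h => ⟨h, hω.2⟩, fun h => h.1⟩

/-- Unbiasedness of the one-bit regression target: `2P` times the centered bit has mean `a`. The
complementary event is the one of `integral_between` at `v = P - a ≥ C`, where centering makes the
surplus equal to its argument. -/
lemma integral_lt_valuation [IsProbabilityMeasure μ] (h : SideModel μ P ν U ξ) (hν : IsNoiseLaw C L ν) {a : ℝ}
    (ha : |a| ≤ P - C) (t : ℕ) :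
    ∫ ω, (if U t ω < a + ξ t ω then (1 : ℝ) else 0) ∂μ = (a + P) / (2 * P) := by
  obtain ⟨ha₁, ha₂⟩ := abs_le.1 ha
  have hP : 0 < P := by linarith [hν.C_pos]
  have h₁ := h.integral_between hν ha (P - a) t
  rw [min_self, hν.surplus_eq (by linarith), sub_add_cancel] at h₁
  have hint : Integrable (fun ω => if a + ξ t ω ≤ U t ω ∧ U t ω ≤ P then (1 : ℝ) else 0) μ := by
    have hs := h.measurableSet_between a (P - a) t
    rw [sub_add_cancel] at hs
    exact Integrable.of_mem_Icc 0 1 (Measurable.ite hs measurable_const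
      measurable_const).aemeasurable (.of_forall fun ω => by split_ifs <;> simp)
  have h₂ : ∫ ω, (if U t ω < a + ξ t ω then (1 : ℝ) else 0) ∂μ =
      ∫ ω, (1 - if a + ξ t ω ≤ U t ω ∧ U t ω ≤ P then (1 : ℝ) else 0) ∂μ := by
    refine integral_congr_ae ?_
    filter_upwards [h.ae_U_mem t] with ω hω
    by_cases hlt : U t ω < a + ξ t ω
    · rw [if_pos hlt, if_neg fun h => absurd h.1 (not_le.2 hlt), sub_zero]
    · rw [if_neg hlt, if_pos ⟨not_lt.1 hlt, hω.2⟩, sub_self]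
  rw [h₂, integral_sub (integrable_const _) hint, h₁]
  simp
  field_simp
  ring

end SideModel

end Concentration

/-! ### The good event of one agent -/

/-- The grid, enlarged by `4` on both sides. -/
def Config.extGrid (cfg : Config) : Finset ℤ := Finset.Icc (-(cfg.K + 4 : ℤ)) (cfg.K + 4)

/-- The estimates that concern one agent, of parameter `θ` and noise law `ν`, are accurate up to
time `T`; `E k` is the kind of the rounds in which the c.d.f. is sampled at the `k`-th point. -/
structure GoodSide (cfg : Config) (x : ℕ → EuclideanSpace ℝ (Fin d)) (T : ℕ) (ψ : ℕ → Phase)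
    (E : ℤ → Phase) (θ : EuclideanSpace ℝ (Fin d)) (ν : Measure ℝ) (u ξ : ℕ → ℝ) : Prop where
  par : ∀ l < T, ∀ τ ≤ T, matNorm (gram x (roundsOf ψ τ .estPar))⁻¹ (x l) ≤ cfg.mu →
    |2 * cfg.P * ∑ i ∈ roundsOf ψ τ .estPar, weight x (roundsOf ψ τ .estPar) (x l) i *
      ((if u i < ⟪x i, θ⟫ + ξ i then 1 else 0) - 1 / 2) - ⟪x l, θ⟫| ≤ 4 * cfg.eps
  cdf : ∀ t ≤ T, ∀ k ∈ cfg.grid, ∀ j ∈ cfg.extGrid, cfg.TFD ≤ (roundsOf ψ t (E k)).card →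
    |(∑ i ∈ roundsOf ψ t (E k), if ξ i ≤ j * cfg.eps then 1 else 0) / (roundsOf ψ t (E k)).card -
      cdfAt ν (j * cfg.eps)| ≤ 2 * cfg.eps
  int : ∀ t ≤ T, ∀ j ∈ cfg.extGrid, cfg.Tint ≤ (roundsOf ψ t .estInt).card →
    |2 * cfg.P / (roundsOf ψ t .estInt).card * (∑ i ∈ roundsOf ψ t .estInt,
        if ⟪x i, θ⟫ + ξ i ≤ u i ∧ u i ≤ j * cfg.eps + ⟪x i, θ⟫ then 1 else 0) -
      clippedSurplus ν cfg.P (fun i => ⟪x i, θ⟫) (roundsOf ψ t .estInt) (j * cfg.eps)| ≤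
      2 * cfg.eps

/-- Conditions on the inputs of the algorithm, for a confidence level `exp (-ℓ)`. -/
structure Config.Tuned (cfg : Config) (A ℓ : ℝ) : Prop where
  eps_pos : 0 < cfg.eps
  mu_pos : 0 < cfg.mu
  pos : 0 < ℓ
  mu_le : cfg.mu * (cfg.P * √ℓ + A) ≤ cfg.eps
  le_Tint : 8 * cfg.P ^ 2 * ℓ ≤ cfg.Tint * cfg.eps ^ 2
  le_TFD : 2 * ℓ ≤ cfg.TFD * cfg.eps ^ 2

lemma measureReal_biUnion_le_card_mul {Ω ι : Type*} [MeasurableSpace Ω] {μ : Measure Ω} (s : Finset ι) (f : ι → Set Ω) {q : ℝ}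
    (h : ∀ i, μ.real (f i) ≤ q) : μ.real (⋃ i ∈ s, f i) ≤ s.card * q := by
  refine (measureReal_biUnion_finset_le s f).trans ?_
  rw [← nsmul_eq_mul]
  exact Finset.sum_le_card_nsmul _ _ _ fun i _ => h i

lemma measureReal_and_le {Ω : Type*} [MeasurableSpace Ω] {μ : Measure Ω} {p : Prop} {f : Ω → Prop} {q : ℝ} (hq : 0 ≤ q)
    (h : p → μ.real {ω | f ω} ≤ q) : μ.real {ω | p ∧ f ω} ≤ q := by
  by_cases hp : p
  · simpa [hp] using h hp
  · simpa [hp] using hq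

section GoodEvent

variable {Ω : Type*} [MeasurableSpace Ω] {μ : Measure Ω} [IsProbabilityMeasure μ]
  {cfg : Config} {x : ℕ → EuclideanSpace ℝ (Fin d)} {A C L ℓ : ℝ} {ν : Measure ℝ}
  {θ : EuclideanSpace ℝ (Fin d)} {U ξ : ℕ → Ω → ℝ}

/-- Ridge bias plus noise: the bias is at most `μA` and the deviation `4μP√ℓ` has the stated
confidence, since the squared weights sum to at most `μ²`. `Tuned.mu_le` turns the total into `4ε`.
-/
lemma measure_par_gt_le (h : SideModel μ cfg.P ν U ξ) (hν : IsNoiseLaw C L ν)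
    (hcfg : cfg.Tuned A ℓ) (hθ : ‖θ‖ ≤ A) (hx : ∀ l, |⟪x l, θ⟫| ≤ cfg.P - C) (s : Finset ℕ)
    (a : EuclideanSpace ℝ (Fin d)) (ha : matNorm (gram x s)⁻¹ a ≤ cfg.mu) :
    μ.real {ω | 4 * cfg.eps < |2 * cfg.P * ∑ i ∈ s, weight x s a i *
      ((if U i ω < ⟪x i, θ⟫ + ξ i ω then 1 else 0) - 1 / 2) - ⟪a, θ⟫|} ≤
      2 * Real.exp (-(8 * ℓ)) := by
  have hP : 0 < cfg.P := by linarith [(abs_nonneg _).trans (hx 0), hν.C_pos]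
  have hr : 0 < 4 * cfg.mu * cfg.P * √ℓ := by
    have := hcfg.mu_pos
    have := Real.sqrt_pos.2 hcfg.pos
    positivity
  have hsq := Real.sq_sqrt hcfg.pos.le
  have hmeas (l : ℕ) :
      Measurable fun z : ℝ × ℝ => if z.1 < ⟪x l, θ⟫ + z.2 then (1 : ℝ) else 0 :=
    Measurable.ite (measurableSet_lt measurable_fst (measurable_snd.const_add _))
      measurable_const measurable_const
  have hmain := measure_le_abs_weighted_sum_le (μ := μ) (s := s)
    (X := fun l ω => if U l ω < ⟪x l, θ⟫ + ξ l ω then (1 : ℝ) else 0)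
    (fun l => (hmeas l).comp ((h.measurable_U l).prodMk (h.measurable_ξ l)))
    (h.indep.comp _ hmeas) (fun l ω => by split_ifs <;> simp)
    (w := fun i => 2 * cfg.P * weight x s a i) (fun l => h.integral_lt_valuation hν (hx l) l)
    (a := 8 * ℓ) hr (by
      simp only [mul_pow, ← Finset.mul_sum, hsq]
      have h₁ := (sum_weight_sq_le x s a).trans
        (pow_le_pow_left₀ (matNorm_nonneg _ _) ha 2)
      have h₂ := mul_le_mul_of_nonneg_left h₁
        (by have := hcfg.pos; positivity : 0 ≤ 32 * cfg.P ^ 2 * ℓ)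
      nlinarith)
  refine (measureReal_mono fun ω hω => ?_).trans hmain
  rw [Set.mem_ofPred_eq] at hω ⊢
  by_contra! hlt
  refine hω.not_ge ?_
  have hbias := abs_sum_weight_mul_inner_sub_le x s a θ
  have hsplit : 2 * cfg.P * ∑ i ∈ s, weight x s a i *
      ((if U i ω < ⟪x i, θ⟫ + ξ i ω then 1 else 0) - 1 / 2) - ⟪a, θ⟫ =
      ∑ i ∈ s, 2 * cfg.P * weight x s a i * ((if U i ω < ⟪x i, θ⟫ + ξ i ω then 1 else 0) -
        (⟪x i, θ⟫ + cfg.P) / (2 * cfg.P)) + (∑ i ∈ s, weight x s a i * ⟪x i, θ⟫ - ⟪a, θ⟫) := by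
    rw [← add_sub_assoc, ← Finset.sum_add_distrib, Finset.mul_sum]
    congr 1
    refine Finset.sum_congr rfl fun i _ => ?_
    field_simp
    ring
  rw [hsplit]
  have h₁ : matNorm (gram x s)⁻¹ a * ‖θ‖ ≤ cfg.mu * A :=
    mul_le_mul ha hθ (norm_nonneg _) hcfg.mu_pos.le
  have h₂ : 0 ≤ cfg.mu * A := (mul_nonneg (matNorm_nonneg _ _) (norm_nonneg _)).trans h₁
  calc _ ≤ _ := abs_add_le _ _
    _ ≤ 4 * cfg.mu * cfg.P * √ℓ + cfg.mu * A := add_le_add hlt.le (hbias.trans h₁)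
    _ ≤ _ := by linarith [hcfg.mu_le]

lemma measure_cdf_gt_le (h : SideModel μ cfg.P ν U ξ) (hcfg : cfg.Tuned A ℓ) (s : Finset ℕ)
    (hs : cfg.TFD ≤ s.card) (v : ℝ) :
    μ.real {ω | 2 * cfg.eps < |(∑ i ∈ s, if ξ i ω ≤ v then 1 else 0) / s.card - cdfAt ν v|} ≤
      2 * Real.exp (-(8 * ℓ)) := by
  have hε := hcfg.eps_pos
  have hℓ := hcfg.pos
  have hcard : 2 * ℓ ≤ s.card * cfg.eps ^ 2 := hcfg.le_TFD.trans (by gcongr)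
  have hpos : (0 : ℝ) < s.card := by
    by_contra! hneg
    nlinarith [sq_nonneg cfg.eps]
  have hmeas (l : ℕ) : Measurable fun z : ℝ × ℝ => if z.2 ≤ v then (1 : ℝ) else 0 :=
    Measurable.ite (measurableSet_le measurable_snd measurable_const)
      measurable_const measurable_const
  have hmain := measure_le_abs_weighted_sum_le (μ := μ) (s := s)
    (X := fun l ω => if ξ l ω ≤ v then (1 : ℝ) else 0)
    (fun l => (hmeas l).comp ((h.measurable_U l).prodMk (h.measurable_ξ l)))
    (h.indep.comp _ hmeas) (fun l ω => by split_ifs <;> simp)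
    (w := fun _ => (s.card : ℝ)⁻¹) (h.integral_le_noise v)
    (a := 8 * ℓ) (r := 2 * cfg.eps) (by positivity) (by
      rw [Finset.sum_const, nsmul_eq_mul,
        show s.card * (s.card : ℝ)⁻¹ ^ 2 * (8 * ℓ) = 8 * ℓ / s.card by field_simp,
        div_le_iff₀ hpos]
      linarith)
  refine (measureReal_mono fun ω hω => ?_).trans hmain
  rw [Set.mem_ofPred_eq] at hω ⊢
  refine hω.le.trans_eq ?_
  rw [← Finset.mul_sum, Finset.sum_sub_distrib, Finset.sum_const, nsmul_eq_mul, mul_sub,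
    inv_mul_cancel_left₀ hpos.ne', div_eq_inv_mul]

lemma measure_int_gt_le (h : SideModel μ cfg.P ν U ξ) (hν : IsNoiseLaw C L ν)
    (hcfg : cfg.Tuned A ℓ) (hx : ∀ l, |⟪x l, θ⟫| ≤ cfg.P - C) (s : Finset ℕ)
    (hs : cfg.Tint ≤ s.card) (v : ℝ) :
    μ.real {ω | 2 * cfg.eps < |2 * cfg.P / s.card * (∑ i ∈ s,
        if ⟪x i, θ⟫ + ξ i ω ≤ U i ω ∧ U i ω ≤ v + ⟪x i, θ⟫ then 1 else 0) -
      clippedSurplus ν cfg.P (fun i => ⟪x i, θ⟫) s v|} ≤ 2 * Real.exp (-(8 * ℓ)) := by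
  have hP : 0 < cfg.P := by linarith [(abs_nonneg _).trans (hx 0), hν.C_pos]
  have hε := hcfg.eps_pos
  have hℓ := hcfg.pos
  have hcard : 8 * cfg.P ^ 2 * ℓ ≤ s.card * cfg.eps ^ 2 := hcfg.le_Tint.trans (by gcongr)
  have hpos : (0 : ℝ) < s.card := by
    by_contra! hneg
    nlinarith [sq_nonneg cfg.eps, (by positivity : 0 < cfg.P ^ 2 * ℓ)]
  have hmeas (l : ℕ) : Measurable fun z : ℝ × ℝ =>
      if ⟪x l, θ⟫ + z.2 ≤ z.1 ∧ z.1 ≤ v + ⟪x l, θ⟫ then (1 : ℝ) else 0 :=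
    Measurable.ite ((measurableSet_le (measurable_snd.const_add _) measurable_fst).inter
      (measurableSet_le measurable_fst measurable_const)) measurable_const measurable_const
  have hmain := measure_le_abs_weighted_sum_le (μ := μ) (s := s)
    (X := fun l ω =>
      if ⟪x l, θ⟫ + ξ l ω ≤ U l ω ∧ U l ω ≤ v + ⟪x l, θ⟫ then (1 : ℝ) else 0)
    (fun l => (hmeas l).comp ((h.measurable_U l).prodMk (h.measurable_ξ l)))
    (h.indep.comp _ hmeas) (fun l ω => by split_ifs <;> simp)
    (w := fun _ => 2 * cfg.P / s.card) (fun l => h.integral_between hν (hx l) v l)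
    (a := 8 * ℓ) (r := 2 * cfg.eps) (by positivity) (by
      rw [Finset.sum_const, nsmul_eq_mul,
        show s.card * (2 * cfg.P / s.card) ^ 2 * (8 * ℓ) = 32 * cfg.P ^ 2 * ℓ / s.card by
          field_simp; ring, div_le_iff₀ hpos]
      linarith [(by positivity : 0 < cfg.P ^ 2 * ℓ)])
  refine (measureReal_mono fun ω hω => ?_).trans hmain
  rw [Set.mem_ofPred_eq] at hω ⊢
  refine hω.le.trans_eq ?_
  rw [← Finset.mul_sum, Finset.sum_sub_distrib, mul_sub, clippedSurplus, ← Finset.sum_div]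
  congr 2
  field_simp

/-- Since `ψ` is a fixed sequence, each event concerns a fixed sample set. The union bound runs over
pairs of context and time, over times with a sampled grid point and a threshold, and over times with
a threshold. -/
lemma measure_not_goodSide_le (h : SideModel μ cfg.P ν U ξ) (hν : IsNoiseLaw C L ν)
    (hcfg : cfg.Tuned A ℓ) (hθ : ‖θ‖ ≤ A) (hx : ∀ l, |⟪x l, θ⟫| ≤ cfg.P - C) (T : ℕ)
    (ψ : ℕ → Phase) (E : ℤ → Phase) :
    μ.real {ω | ¬ GoodSide cfg x T ψ E θ ν (fun t => U t ω) (fun t => ξ t ω)} ≤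
      (T * (T + 1) + (T + 1) * (cfg.extGrid.card * cfg.extGrid.card)
        + (T + 1) * cfg.extGrid.card) * (2 * Real.exp (-(8 * ℓ))) := by
  have hq : 0 ≤ 2 * Real.exp (-(8 * ℓ)) := by positivity
  have h₁ := measureReal_biUnion_le_card_mul (μ := μ) (Finset.range T ×ˢ Finset.range (T + 1)) _
    fun i => measureReal_and_le hq
      (measure_par_gt_le h hν hcfg hθ hx (roundsOf ψ i.2 .estPar) (x i.1))
  have h₂ := measureReal_biUnion_le_card_mul (μ := μ)
    (Finset.range (T + 1) ×ˢ (cfg.extGrid ×ˢ cfg.extGrid)) _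
    fun i => measureReal_and_le hq
      fun hi => measure_cdf_gt_le h hcfg (roundsOf ψ i.1 (E i.2.1)) hi (i.2.2 * cfg.eps)
  have h₃ := measureReal_biUnion_le_card_mul (μ := μ) (Finset.range (T + 1) ×ˢ cfg.extGrid) _
    fun i => measureReal_and_le hq
      fun hi => measure_int_gt_le h hν hcfg hx (roundsOf ψ i.1 .estInt) hi (i.2 * cfg.eps)
  simp only [Finset.card_product, Finset.card_range, Nat.cast_mul, Nat.cast_add,
    Nat.cast_one] at h₁ h₂ h₃
  rw [add_mul, add_mul]
  refine le_trans (measureReal_mono ?_) <| (measureReal_union_le _ _).trans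
    (add_le_add ((measureReal_union_le _ _).trans (add_le_add h₁ h₂)) h₃)
  intro ω hω
  by_contra hcon
  simp only [Set.mem_union, Set.mem_iUnion, Finset.mem_product, Finset.mem_range,
    Set.mem_ofPred_eq, not_or, not_exists, not_and, not_lt, Nat.lt_succ_iff] at hcon
  obtain ⟨⟨hpar, hcdf⟩, hint⟩ := hcon
  refine hω ⟨fun l hl τ hτ => hpar (l, τ) ⟨hl, hτ⟩, fun t ht k hk j hj => ?_,
    fun t ht j hj => hint (t, j) ⟨ht, hj⟩⟩
  -- The union was taken over `extGrid` for `k` too, only to have a single cardinality in the bound.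
  refine hcdf (t, k, j) ⟨ht, ?_, hj⟩
  simp only [Config.grid, Config.extGrid, Finset.mem_Icc] at hk ⊢
  omega

end GoodEvent

/-! ### Accuracy of the estimates along a run -/

section Run

variable {cfg : Config} {ch : Choice} {x : ℕ → EuclideanSpace ℝ (Fin d)} {u s b : ℕ → ℝ} {t : ℕ}

lemma priceAt_estPar (h : phaseAt cfg ch x u s b t = .estPar) : priceAt cfg ch x u s b t = u t := by
  rw [priceAt, h]; rfl

lemma priceAt_estInt (h : phaseAt cfg ch x u s b t = .estInt) : priceAt cfg ch x u s b t = u t := by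
  rw [priceAt, h]; rfl

lemma priceAt_estF {k : ℤ} (h : phaseAt cfg ch x u s b t = .estF k) : priceAt cfg ch x u s b t =
    ⟪x t, (stateAt cfg ch x u s b t).thetaS cfg⟫ + k * cfg.eps := by
  rw [priceAt, h]; rfl

lemma priceAt_estD {k : ℤ} (h : phaseAt cfg ch x u s b t = .estD k) : priceAt cfg ch x u s b t =
    ⟪x t, (stateAt cfg ch x u s b t).thetaB cfg⟫ + k * cfg.eps := by
  rw [priceAt, h]; rfl

lemma priceAt_commit (h : phaseAt cfg ch x u s b t = .commit) : priceAt cfg ch x u s b t =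
    ⟪x t, (stateAt cfg ch x u s b t).thetaS cfg⟫ +
      (ch.tie t ((stateAt cfg ch x u s b t).best cfg (x t))).1 * cfg.eps := by
  rw [priceAt, h]; rfl

variable (cfg ch x u s b)

lemma inner_thetaS_stateAt (t : ℕ) (a : EuclideanSpace ℝ (Fin d)) :
    ⟪a, (stateAt cfg ch x u s b t).thetaS cfg⟫ =
      2 * cfg.P * ∑ i ∈ roundsOf (phaseAt cfg ch x u s b) t .estPar,
        weight x (roundsOf (phaseAt cfg ch x u s b) t .estPar) a i *
          ((if u i < s i then 1 else 0) - 1 / 2) := by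
  have hsum : ∑ l ∈ roundsOf (phaseAt cfg ch x u s b) t .estPar,
      ((if ((stateAt cfg ch x u s b t).hist l).sellerAccepts then (0 : ℝ) else 1) - 1 / 2) •
        ((stateAt cfg ch x u s b t).hist l).x.ofLp =
      ∑ l ∈ roundsOf (phaseAt cfg ch x u s b) t .estPar,
        ((if u l < s l then (1 : ℝ) else 0) - 1 / 2) • (x l).ofLp := by
    refine Finset.sum_congr rfl fun i hi => ?_
    rw [mem_roundsOf] at hi
    rw [hist_stateAt _ _ _ _ _ _ hi.1, priceAt_estPar hi.2]
    by_cases h : s i ≤ u i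
    · simp [h, h.not_gt]
    · simp [h, not_le.1 h]
  rw [State.thetaS, V_stateAt, Tpar_stateAt, hsum, inner_toLp_smul_inv_mulVec]

/-- The buyer's estimate is minus the seller's estimate for negated data; the strict inequality on
the right is the complement of the buyer's weak one. -/
lemma inner_thetaB_stateAt (t : ℕ) (a : EuclideanSpace ℝ (Fin d)) :
    ⟪a, (stateAt cfg ch x u s b t).thetaB cfg⟫ =
      -(2 * cfg.P * ∑ i ∈ roundsOf (phaseAt cfg ch x u s b) t .estPar,
        weight x (roundsOf (phaseAt cfg ch x u s b) t .estPar) a i *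
          ((if -u i < -b i then 1 else 0) - 1 / 2)) := by
  have hsum : ∑ l ∈ roundsOf (phaseAt cfg ch x u s b) t .estPar,
      ((if ((stateAt cfg ch x u s b t).hist l).buyerAccepts then (1 : ℝ) else 0) - 1 / 2) •
        ((stateAt cfg ch x u s b t).hist l).x.ofLp =
      ∑ l ∈ roundsOf (phaseAt cfg ch x u s b) t .estPar,
        ((if u l ≤ b l then (1 : ℝ) else 0) - 1 / 2) • (x l).ofLp := by
    refine Finset.sum_congr rfl fun i hi => ?_
    rw [mem_roundsOf] at hi
    rw [hist_stateAt _ _ _ _ _ _ hi.1, priceAt_estPar hi.2]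
    simp only [decide_eq_true_eq]
  rw [State.thetaB, V_stateAt, Tpar_stateAt, hsum, inner_toLp_smul_inv_mulVec, ← mul_neg,
    ← Finset.sum_neg_distrib]
  congr 1
  refine Finset.sum_congr rfl fun i _ => ?_
  rcases le_or_gt (u i) (b i) with h | h
  · rw [if_pos h, if_neg (by linarith)]
    ring
  · rw [if_neg h.not_ge, if_pos (neg_lt_neg h)]
    ring

end Run

/-! ### Sandwiching the estimates -/

section Sandwich

variable {cfg : Config} {x : ℕ → EuclideanSpace ℝ (Fin d)} {T : ℕ} {ψ : ℕ → Phase}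
  {E : ℤ → Phase} {θ : EuclideanSpace ℝ (Fin d)} {ν : Measure ℝ} {u ξ : ℕ → ℝ} {C L : ℝ}
  {β : ℕ → Prop} [DecidablePred β] {t : ℕ} {k m : ℤ} {w : ℝ}

lemma sum_ite_le_sum_ite {s : Finset ℕ} {p q : ℕ → Prop} [DecidablePred p] [DecidablePred q]
    (h : ∀ i ∈ s, p i → q i) :
    ∑ i ∈ s, (if p i then (1 : ℝ) else 0) ≤ ∑ i ∈ s, if q i then (1 : ℝ) else 0 := by
  refine Finset.sum_le_sum fun i hi => ?_
  by_cases hp : p i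
  · rw [if_pos hp, if_pos (h i hi hp)]
  · rw [if_neg hp]
    split_ifs <;> simp

lemma mem_grid_iff : m ∈ cfg.grid ↔ |m| ≤ cfg.K := by
  rw [Config.grid, Finset.mem_Icc, abs_le]

lemma mem_extGrid_of_mem_grid (hm : m ∈ cfg.grid) :
    m + 4 ∈ cfg.extGrid ∧ m - 4 ∈ cfg.extGrid := by
  simp only [Config.grid, Config.extGrid, Finset.mem_Icc] at hm ⊢
  omega

lemma neg_mem_grid (hm : m ∈ cfg.grid) : -m ∈ cfg.grid := by
  rwa [mem_grid_iff, abs_neg, ← mem_grid_iff]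

namespace GoodSide

/-- The event `β` may depend on the data in any way; only its position between the thresholds `(m ±
4)ε` is used. Each threshold is within `9ε` of `w`, which costs `9Lε` on top of the sampling error
`2ε`. The index `m` is separate from `k` because the buyer needs `m = -k`. -/
lemma abs_avg_sub_cdfAt_le (hG : GoodSide cfg x T ψ E θ ν u ξ) (hν : IsNoiseLaw C L ν)
    (ht : t ≤ T) (hk : k ∈ cfg.grid) (hm : m ∈ cfg.grid)
    (hcard : cfg.TFD ≤ (roundsOf ψ t (E k)).card)
    (hlow : ∀ i ∈ roundsOf ψ t (E k), ξ i ≤ (m - 4) * cfg.eps → β i)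
    (hup : ∀ i ∈ roundsOf ψ t (E k), β i → ξ i ≤ (m + 4) * cfg.eps)
    (hw : |w - m * cfg.eps| ≤ 5 * cfg.eps) :
    |(∑ i ∈ roundsOf ψ t (E k), if β i then 1 else 0) / (roundsOf ψ t (E k)).card - cdfAt ν w| ≤
      (9 * L + 2) * cfg.eps := by
  obtain ⟨hm₁, hm₂⟩ := mem_extGrid_of_mem_grid hm
  have h₁ := abs_le.1 (hG.cdf t ht k hk _ hm₁ hcard)
  have h₂ := abs_le.1 (hG.cdf t ht k hk _ hm₂ hcard)
  push_cast at h₁ h₂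
  have hn : (0 : ℝ) ≤ (roundsOf ψ t (E k)).card := Nat.cast_nonneg _
  have h₃ := div_le_div_of_nonneg_right (sum_ite_le_sum_ite hlow) hn
  have h₄ := div_le_div_of_nonneg_right (sum_ite_le_sum_ite hup) hn
  obtain ⟨hw₁, hw₂⟩ := abs_le.1 hw
  have hL := hν.L_nonneg
  have key {v v' : ℝ} (h : v - v' ≤ 9 * cfg.eps) (hε : 0 ≤ 9 * cfg.eps) :
      cdfAt ν v - cdfAt ν v' ≤ L * (9 * cfg.eps) := by
    rcases le_total v v' with hv | hv
    · exact (sub_nonpos.2 (hν.cdfAt_mono hv)).trans (mul_nonneg hL hε)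
    · exact (hν.cdfAt_sub_le hv).trans (by gcongr)
  have hε : 0 ≤ 9 * cfg.eps := by linarith
  have h₅ := key (v := w) (v' := (m - 4) * cfg.eps) (by linarith) hε
  have h₆ := key (v := (m + 4) * cfg.eps) (v' := w) (by linarith) hε
  rw [abs_le]
  constructor <;> linarith [h₁.2, h₂.1]

lemma abs_avg_sub_clippedSurplus_le (hG : GoodSide cfg x T ψ E θ ν u ξ) (hν : IsNoiseLaw C L ν)
    (hP : 0 ≤ cfg.P) (ht : t ≤ T) (hm : m ∈ cfg.grid)
    (hne : (roundsOf ψ t .estInt).Nonempty) (hcard : cfg.Tint ≤ (roundsOf ψ t .estInt).card)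
    (hlow : ∀ i ∈ roundsOf ψ t .estInt,
      ⟪x i, θ⟫ + ξ i ≤ u i ∧ u i ≤ (m - 4) * cfg.eps + ⟪x i, θ⟫ → β i)
    (hup : ∀ i ∈ roundsOf ψ t .estInt,
      β i → ⟪x i, θ⟫ + ξ i ≤ u i ∧ u i ≤ (m + 4) * cfg.eps + ⟪x i, θ⟫)
    (hw : |w - m * cfg.eps| ≤ 5 * cfg.eps) :
    |2 * cfg.P / (roundsOf ψ t .estInt).card * (∑ i ∈ roundsOf ψ t .estInt, if β i then 1 else 0) -
      clippedSurplus ν cfg.P (fun i => ⟪x i, θ⟫) (roundsOf ψ t .estInt) w| ≤ 11 * cfg.eps := by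
  obtain ⟨hm₁, hm₂⟩ := mem_extGrid_of_mem_grid hm
  have h₁ := abs_le.1 (hG.int t ht _ hm₁ hcard)
  have h₂ := abs_le.1 (hG.int t ht _ hm₂ hcard)
  push_cast at h₁ h₂
  have hn : 0 ≤ 2 * cfg.P / (roundsOf ψ t .estInt).card := by positivity
  have h₃ := mul_le_mul_of_nonneg_left (sum_ite_le_sum_ite hlow) hn
  have h₄ := mul_le_mul_of_nonneg_left (sum_ite_le_sum_ite hup) hn
  obtain ⟨hw₁, hw₂⟩ := abs_le.1 hw
  have key {v v' : ℝ} (h : v - v' ≤ 9 * cfg.eps) (hε : 0 ≤ 9 * cfg.eps) :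
      clippedSurplus ν cfg.P (fun i => ⟪x i, θ⟫) (roundsOf ψ t .estInt) v -
        clippedSurplus ν cfg.P (fun i => ⟪x i, θ⟫) (roundsOf ψ t .estInt) v' ≤ 9 * cfg.eps := by
    rcases le_total v v' with hv | hv
    · exact (sub_nonpos.2 (clippedSurplus_mono hν hv)).trans hε
    · exact (clippedSurplus_sub_le hν hne hv).trans h
  have hε : 0 ≤ 9 * cfg.eps := by linarith
  have h₅ := key (v := w) (v' := (m - 4) * cfg.eps) (by linarith) hε
  have h₆ := key (v := (m + 4) * cfg.eps) (v' := w) (by linarith) hε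
  rw [abs_le]
  constructor <;> linarith [h₁.2, h₂.1]

end GoodSide

end Sandwich

/-! ### Commit rounds -/

section Commit

variable {cfg : Config} {ch : Choice} {x : ℕ → EuclideanSpace ℝ (Fin d)} {T : ℕ}
  {θs θb : EuclideanSpace ℝ (Fin d)} {νs νb : Measure ℝ} {u s b : ℕ → ℝ} {C L : ℝ}

/-- A run in which the estimates that concern both agents are accurate; the valuations are `s` and
`b`. The buyer is a seller for the opposite prices. -/
structure GoodRun (cfg : Config) (ch : Choice) (x : ℕ → EuclideanSpace ℝ (Fin d)) (T : ℕ)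
    (θs θb : EuclideanSpace ℝ (Fin d)) (νs νb : Measure ℝ) (u s b : ℕ → ℝ) : Prop where
  seller : GoodSide cfg x T (phaseAt cfg ch x u s b) .estF θs νs u (fun t => s t - ⟪x t, θs⟫)
  buyer : GoodSide cfg x T (phaseAt cfg ch x u s b) .estD (-θb) (νb.map Neg.neg) (fun t => -u t)
    (fun t => ⟪x t, θb⟫ - b t)

namespace GoodRun

lemma abs_inner_thetaS_sub_le (h : GoodRun cfg ch x T θs θb νs νb u s b) {l τ : ℕ} (hl : l < T)
    (hτ : τ ≤ T) (hmu : matNorm (gram x (roundsOf (phaseAt cfg ch x u s b) τ .estPar))⁻¹ (x l) ≤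
      cfg.mu) :
    |⟪x l, (stateAt cfg ch x u s b τ).thetaS cfg⟫ - ⟪x l, θs⟫| ≤ 4 * cfg.eps := by
  have := h.seller.par l hl τ hτ hmu
  simp only [add_sub_cancel] at this
  rwa [inner_thetaS_stateAt]

lemma abs_inner_thetaB_sub_le (h : GoodRun cfg ch x T θs θb νs νb u s b) {l τ : ℕ} (hl : l < T)
    (hτ : τ ≤ T) (hmu : matNorm (gram x (roundsOf (phaseAt cfg ch x u s b) τ .estPar))⁻¹ (x l) ≤
      cfg.mu) :
    |⟪x l, (stateAt cfg ch x u s b τ).thetaB cfg⟫ - ⟪x l, θb⟫| ≤ 4 * cfg.eps := by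
  have := h.buyer.par l hl τ hτ hmu
  simp only [inner_neg_right, neg_add_eq_sub, sub_sub_cancel_left] at this
  rw [inner_thetaB_stateAt, ← abs_neg]
  convert this using 2
  ring

/-- A context that was well covered when it appeared stays so under all later Gram matrices, so
later parameter estimates remain accurate at it. -/
lemma matNorm_le_mu {l τ : ℕ} (hlτ : l ≤ τ) (hl : phaseAt cfg ch x u s b l ≠ .estPar) :
    matNorm (gram x (roundsOf (phaseAt cfg ch x u s b) τ .estPar))⁻¹ (x l) ≤ cfg.mu :=
  (matNorm_gram_anti x (roundsOf_mono _ _ hlτ) (x l)).trans (le_mu_of_phaseAt hl)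

/-- In such a round the seller accepts when the noise is at most `kε` plus the current parameter
error at `x_i`. That error varies with the round but never exceeds `4ε`. -/
lemma abs_Fhat_sub_le (h : GoodRun cfg ch x T θs θb νs νb u s b) (hν : IsNoiseLaw C L νs) {t : ℕ}
    (ht : t ≤ T) {k : ℤ} (hk : k ∈ cfg.grid)
    (hcard : cfg.TFD ≤ (roundsOf (phaseAt cfg ch x u s b) t (.estF k)).card) {w : ℝ}
    (hw : |w - k * cfg.eps| ≤ 5 * cfg.eps) :
    |(stateAt cfg ch x u s b t).Fhat k - cdfAt νs w| ≤ (9 * L + 2) * cfg.eps := by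
  have hθ {i : ℕ} (hi : i ∈ roundsOf (phaseAt cfg ch x u s b) t (.estF k)) := by
    rw [mem_roundsOf] at hi
    exact abs_le.1 (h.abs_inner_thetaS_sub_le (hi.1.trans_le ht) (hi.1.trans_le ht).le
      (matNorm_le_mu le_rfl (by rw [hi.2]; simp)))
  rw [State.Fhat, TF_stateAt]
  rw [Finset.sum_congr rfl fun i hi => by
    rw [hist_stateAt _ _ _ _ _ _ (mem_roundsOf.1 hi).1, priceAt_estF (mem_roundsOf.1 hi).2]]
  simp only [decide_eq_true_eq]
  refine h.seller.abs_avg_sub_cdfAt_le hν ht hk hk hcard (fun i hi hle => ?_)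
    (fun i hi hle => ?_) hw
  · linarith [(hθ hi).1]
  · linarith [(hθ hi).2]

lemma abs_Dhat_sub_le (h : GoodRun cfg ch x T θs θb νs νb u s b) (hν : IsNoiseLaw C L νb) {t : ℕ}
    (ht : t ≤ T) {k : ℤ} (hk : k ∈ cfg.grid)
    (hcard : cfg.TFD ≤ (roundsOf (phaseAt cfg ch x u s b) t (.estD k)).card) {w : ℝ}
    (hw : |w + k * cfg.eps| ≤ 5 * cfg.eps) :
    |(stateAt cfg ch x u s b t).Dhat k - cdfAt (νb.map Neg.neg) w| ≤ (9 * L + 2) * cfg.eps := by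
  have hθ {i : ℕ} (hi : i ∈ roundsOf (phaseAt cfg ch x u s b) t (.estD k)) := by
    rw [mem_roundsOf] at hi
    exact abs_le.1 (h.abs_inner_thetaB_sub_le (hi.1.trans_le ht) (hi.1.trans_le ht).le
      (matNorm_le_mu le_rfl (by rw [hi.2]; simp)))
  rw [State.Dhat, TD_stateAt]
  rw [Finset.sum_congr rfl fun i hi => by
    rw [hist_stateAt _ _ _ _ _ _ (mem_roundsOf.1 hi).1, priceAt_estD (mem_roundsOf.1 hi).2]]
  simp only [decide_eq_true_eq]
  refine h.buyer.abs_avg_sub_cdfAt_le hν.map_neg ht hk (neg_mem_grid hk) hcard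
    (fun i hi hle => ?_) (fun i hi hle => ?_) (by push_cast; rwa [neg_mul, sub_neg_eq_add])
  · push_cast at hle
    linarith [(hθ hi).2]
  · push_cast
    linarith [(hθ hi).1]

lemma abs_Jhat_sub_le (h : GoodRun cfg ch x T θs θb νs νb u s b) (hν : IsNoiseLaw C L νs)
    (hP : 0 ≤ cfg.P) {t : ℕ} (ht : t ≤ T) {k : ℤ} (hk : k ∈ cfg.grid)
    (hne : (roundsOf (phaseAt cfg ch x u s b) t .estInt).Nonempty)
    (hcard : cfg.Tint ≤ (roundsOf (phaseAt cfg ch x u s b) t .estInt).card) {w : ℝ}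
    (hw : |w - k * cfg.eps| ≤ 5 * cfg.eps) :
    |(stateAt cfg ch x u s b t).Jhat k - clippedSurplus νs cfg.P (fun i => ⟪x i, θs⟫)
      (roundsOf (phaseAt cfg ch x u s b) t .estInt) w| ≤ 11 * cfg.eps := by
  -- The stored estimate used the parameter estimate of time `τ`, the last refresh, and not that of
  -- time `t`; all its contexts were seen before `τ`, so `matNorm_le_mu` applies at `τ`.
  obtain ⟨τ, hτ, hr, -, hJ⟩ := exists_estimates_eq cfg ch x u s b t hne
  rw [← hr] at hne hcard ⊢
  have hθ {i : ℕ} (hi : i ∈ roundsOf (phaseAt cfg ch x u s b) τ .estInt) := by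
    rw [mem_roundsOf] at hi
    exact abs_le.1 (h.abs_inner_thetaS_sub_le (hi.1.trans_le (hτ.trans ht)) (hτ.trans ht)
      (matNorm_le_mu hi.1.le (by rw [hi.2]; simp)))
  rw [hJ, State.estJ, Tint_stateAt]
  rw [Finset.sum_congr rfl fun i hi => by
    rw [hist_stateAt _ _ _ _ _ _ (mem_roundsOf.1 hi).1, priceAt_estInt (mem_roundsOf.1 hi).2]]
  simp only [decide_eq_true_eq]
  refine h.seller.abs_avg_sub_clippedSurplus_le hν hP (hτ.trans ht) hk hne hcard
    (fun i hi hle => ⟨?_, ?_⟩) (fun i hi hle => ⟨?_, ?_⟩) hw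
  · linarith [hle.1]
  · linarith [hle.2, (hθ hi).1]
  · linarith [hle.1]
  · linarith [hle.2, (hθ hi).2]

lemma abs_Ihat_sub_le (h : GoodRun cfg ch x T θs θb νs νb u s b) (hν : IsNoiseLaw C L νb)
    (hP : 0 ≤ cfg.P) {t : ℕ} (ht : t ≤ T) {k : ℤ} (hk : k ∈ cfg.grid)
    (hne : (roundsOf (phaseAt cfg ch x u s b) t .estInt).Nonempty)
    (hcard : cfg.Tint ≤ (roundsOf (phaseAt cfg ch x u s b) t .estInt).card) {w : ℝ}
    (hw : |w + k * cfg.eps| ≤ 5 * cfg.eps) :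
    |(stateAt cfg ch x u s b t).Ihat k - clippedSurplus (νb.map Neg.neg) cfg.P
      (fun i => ⟪x i, -θb⟫) (roundsOf (phaseAt cfg ch x u s b) t .estInt) w| ≤ 11 * cfg.eps := by
  obtain ⟨τ, hτ, hr, hI, -⟩ := exists_estimates_eq cfg ch x u s b t hne
  rw [← hr] at hne hcard ⊢
  have hθ {i : ℕ} (hi : i ∈ roundsOf (phaseAt cfg ch x u s b) τ .estInt) := by
    rw [mem_roundsOf] at hi
    exact abs_le.1 (h.abs_inner_thetaB_sub_le (hi.1.trans_le (hτ.trans ht)) (hτ.trans ht)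
      (matNorm_le_mu hi.1.le (by rw [hi.2]; simp)))
  rw [hI, State.estI, Tint_stateAt]
  rw [Finset.sum_congr rfl fun i hi => by
    rw [hist_stateAt _ _ _ _ _ _ (mem_roundsOf.1 hi).1, priceAt_estInt (mem_roundsOf.1 hi).2]]
  simp only [decide_eq_true_eq]
  refine h.buyer.abs_avg_sub_clippedSurplus_le hν.map_neg hP (hτ.trans ht) (neg_mem_grid hk) hne
    hcard (fun i hi hle => ⟨?_, ?_⟩) (fun i hi hle => ⟨?_, ?_⟩)
    (by push_cast; rwa [neg_mul, sub_neg_eq_add]) <;>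
  simp only [inner_neg_right, Int.cast_neg] at hle ⊢
  · linarith [hle.2, (hθ hi).2]
  · linarith [hle.1]
  · linarith [hle.2]
  · linarith [hle.1, (hθ hi).1]

end GoodRun

lemma abs_mul_sub_mul_le {a a' c c' r q N : ℝ} (ha : |a| ≤ 1) (hc' : 0 ≤ c' ∧ c' ≤ N)
    (haa : |a - a'| ≤ r) (hcc : |c - c'| ≤ q) : |a * c - a' * c'| ≤ q + N * r := by
  have h : a * c - a' * c' = a * (c - c') + c' * (a - a') := by ring
  rw [h]
  refine (abs_add_le _ _).trans ?_
  rw [abs_mul, abs_mul, abs_of_nonneg hc'.1]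
  have h₁ : |a| * |c - c'| ≤ 1 * q := mul_le_mul ha hcc (abs_nonneg _) zero_le_one
  have h₂ : c' * |a - a'| ≤ N * r := mul_le_mul hc'.2 haa (abs_nonneg _) (hc'.1.trans hc'.2)
  linarith

lemma abs_avg_ite_le_one (s : Finset ℕ) (β : ℕ → Prop) [DecidablePred β] :
    |(∑ i ∈ s, if β i then (1 : ℝ) else 0) / s.card| ≤ 1 := by
  rw [Finset.sum_boole, abs_of_nonneg (by positivity)]
  exact div_le_one_of_le₀ (by exact_mod_cast Finset.card_filter_le _ _) (Nat.cast_nonneg _)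

lemma mem_grid_of_abs_le {k : ℤ} (hε : 0 < cfg.eps) (hk : |k * cfg.eps| ≤ 2 * cfg.P) :
    k ∈ cfg.grid := by
  rw [abs_mul, abs_of_pos hε, ← le_div_iff₀ hε] at hk
  have h := hk.trans (Nat.le_ceil _)
  rw [mem_grid_iff, Config.K]
  have : |k| ≤ (⌈2 * cfg.P / cfg.eps⌉₊ : ℤ) := by exact_mod_cast h
  push_cast
  linarith

lemma abs_le_of_mem_grid {k : ℤ} (hε : 0 < cfg.eps) (hP : 0 ≤ cfg.P) (hk : k ∈ cfg.grid) :
    |k * cfg.eps| ≤ 2 * cfg.P + 4 * cfg.eps := by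
  rw [mem_grid_iff] at hk
  have h₁ : |(k : ℝ)| ≤ cfg.K := by exact_mod_cast hk
  have h₂ : (cfg.K : ℝ) ≤ 2 * cfg.P / cfg.eps + 4 := by
    rw [Config.K]
    push_cast
    linarith [(Nat.ceil_lt_add_one (by positivity : 0 ≤ 2 * cfg.P / cfg.eps)).le]
  rw [abs_mul, abs_of_pos hε]
  calc _ ≤ (2 * cfg.P / cfg.eps + 4) * cfg.eps := by gcongr; exact h₁.trans h₂
    _ = _ := by field_simp

/-- Regret of a commit round relative to the price `p`. -/
lemma GoodRun.egft_sub_le (h : GoodRun cfg ch x T θs θb νs νb u s b)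
    (hs : IsNoiseLaw C L νs) (hb : IsNoiseLaw C L νb) (hε : 0 < cfg.eps) (hεC : 6 * cfg.eps ≤ C)
    (hTint : 0 < cfg.Tint) (hθs : ∀ l, |⟪x l, θs⟫| ≤ cfg.P - C)
    (hθb : ∀ l, |⟪x l, θb⟫| ≤ cfg.P - C) {t : ℕ} (ht : t < T)
    (hφ : phaseAt cfg ch x u s b t = .commit) (p : ℝ) :
    egft θs θb νs νb (x t) p p - egft θs θb νs νb (x t) (priceAt cfg ch x u s b t)
      (priceAt cfg ch x u s b t) ≤
      (1 + 4 * cfg.P / C) * ((46 + 16 * cfg.P + 76 * cfg.P * L) * cfg.eps) := by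
  have hC := hs.C_pos
  have hPC : C ≤ cfg.P := by linarith [(abs_nonneg _).trans (hθs 0)]
  have hP : 0 < cfg.P := hC.trans_le hPC
  have hL := hs.L_nonneg
  set S := stateAt cfg ch x u s b t with hS
  set ψ := phaseAt cfg ch x u s b with hψ
  set n := roundsOf ψ t .estInt with hn
  obtain ⟨hcard, hFD⟩ := le_card_of_phaseAt_commit hφ
  have hne : n.Nonempty := Finset.card_pos.1 (hTint.trans_le hcard)
  have hmu := GoodRun.matNorm_le_mu (ch := ch) (x := x) (u := u) (s := s) (b := b)
    (cfg := cfg) (le_refl t) (by rw [← hψ, hφ]; simp)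
  have eS := abs_le.1 (h.abs_inner_thetaS_sub_le ht ht.le hmu)
  have eB := abs_le.1 (h.abs_inner_thetaB_sub_le ht ht.le hmu)
  rw [← hS] at eS eB
  set F := cdfAt νs
  set G := cdfAt (νb.map Neg.neg)
  set Jt := clippedSurplus νs cfg.P (fun i => ⟪x i, θs⟫) n with hJt
  set It := clippedSurplus (νb.map Neg.neg) cfg.P (fun i => ⟪x i, -θb⟫) n with hIt
  have hbS : ∀ l, C ≤ cfg.P - ⟪x l, θs⟫ ∧ cfg.P - ⟪x l, θs⟫ ≤ 2 * cfg.P := fun l => by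
    have := abs_le.1 (hθs l)
    constructor <;> linarith
  have hbB : ∀ l, C ≤ cfg.P - ⟪x l, -θb⟫ ∧ cfg.P - ⟪x l, -θb⟫ ≤ 2 * cfg.P := fun l => by
    have := abs_le.1 (hθb l)
    rw [inner_neg_right]
    constructor <;> linarith
  have bJ : ∀ w, 0 ≤ Jt w ∧ Jt w ≤ 2 * cfg.P := fun w =>
    ⟨clippedSurplus_nonneg w, clippedSurplus_le hs hne hbS w⟩
  have bI : ∀ w, 0 ≤ It w ∧ It w ≤ 2 * cfg.P := fun w =>
    ⟨clippedSurplus_nonneg w, clippedSurplus_le hb.map_neg hne hbB w⟩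
  have bF : ∀ w, |F w| ≤ 1 := fun w => by
    rw [abs_of_nonneg (IsNoiseLaw.cdfAt_nonneg _ _)]
    exact hs.cdfAt_le_one w
  have bG : ∀ w, |G w| ≤ 1 := fun w => by
    rw [abs_of_nonneg (IsNoiseLaw.cdfAt_nonneg _ _)]
    exact hb.map_neg.cdfAt_le_one w
  -- position of the price of a pair of grid points
  have hpos : ∀ a ∈ S.pairs cfg (x t), a.1 ∈ cfg.grid ∧ a.2 ∈ cfg.grid ∧
      |⟪x t, S.thetaS cfg⟫ + a.1 * cfg.eps - ⟪x t, θs⟫ - a.1 * cfg.eps| ≤ 5 * cfg.eps ∧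
      |⟪x t, θb⟫ - (⟪x t, S.thetaS cfg⟫ + a.1 * cfg.eps) + a.2 * cfg.eps| ≤ 5 * cfg.eps := by
    intro a ha
    simp only [State.pairs, Finset.mem_filter, Finset.mem_product] at ha
    obtain ⟨⟨h₁, h₂⟩, h₃⟩ := ha
    refine ⟨h₁, h₂, ?_, ?_⟩
    · rw [abs_le]
      constructor <;> linarith
    · have h₄ := Int.floor_le ((a.1 * cfg.eps - ⟪x t, S.thetaB cfg - S.thetaS cfg⟫) / cfg.eps)
      have h₅ := Int.lt_floor_add_one
        ((a.1 * cfg.eps - ⟪x t, S.thetaB cfg - S.thetaS cfg⟫) / cfg.eps)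
      rw [← h₃, le_div_iff₀ hε, inner_sub_right] at h₄
      rw [← h₃, div_lt_iff₀ hε, inner_sub_right] at h₅
      rw [abs_le]
      constructor <;> linarith
  -- accuracy of the score
  have hscore : ∀ a ∈ S.pairs cfg (x t), |S.score a - tradeValue F Jt G It
      (⟪x t, S.thetaS cfg⟫ + a.1 * cfg.eps - ⟪x t, θs⟫)
      (⟪x t, θb⟫ - (⟪x t, S.thetaS cfg⟫ + a.1 * cfg.eps))| ≤
      (22 + 4 * cfg.P * (9 * L + 2)) * cfg.eps := by
    intro a ha
    obtain ⟨h₁, h₂, h₃, h₄⟩ := hpos a ha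
    have k₁ := h.abs_Fhat_sub_le hs ht.le h₁ (hFD _ h₁).1 h₃
    have k₂ := h.abs_Dhat_sub_le hb ht.le h₂ (hFD _ h₂).2 h₄
    have k₃ := h.abs_Jhat_sub_le hs hP.le ht.le h₁ hne hcard h₃
    have k₄ := h.abs_Ihat_sub_le hb hP.le ht.le h₂ hne hcard h₄
    have m₁ := abs_mul_sub_mul_le (abs_avg_ite_le_one _ _ : |S.Fhat a.1| ≤ 1) (bI _) k₁ k₄
    have m₂ := abs_mul_sub_mul_le (abs_avg_ite_le_one _ _ : |S.Dhat a.2| ≤ 1) (bJ _) k₂ k₃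
    rw [State.score, tradeValue, add_sub_add_comm]
    exact (abs_add_le _ _).trans ((add_le_add m₁ m₂).trans (by linarith))
  -- every price is approximated by a pair of grid points
  have hcover : ∀ p ∈ Set.Icc (-cfg.P) cfg.P, ∃ a ∈ S.pairs cfg (x t),
      tradeValue F Jt G It (p - ⟪x t, θs⟫) (⟪x t, θb⟫ - p) ≤
        S.score a + (22 + 4 * cfg.P * (9 * L + 2)) * cfg.eps +
          (2 + 4 * cfg.P * L) * cfg.eps := by
    intro p hp
    have bs := abs_le.1 (hθs t)
    have bb := abs_le.1 (hθb t)
    set k := ⌊(p - ⟪x t, S.thetaS cfg⟫) / cfg.eps⌋ with hk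
    set k' := ⌊(k * cfg.eps - ⟪x t, S.thetaB cfg - S.thetaS cfg⟫) / cfg.eps⌋ with hk'
    have f₁ := Int.floor_le ((p - ⟪x t, S.thetaS cfg⟫) / cfg.eps)
    have f₂ := Int.lt_floor_add_one ((p - ⟪x t, S.thetaS cfg⟫) / cfg.eps)
    have f₃ := Int.floor_le ((k * cfg.eps - ⟪x t, S.thetaB cfg - S.thetaS cfg⟫) / cfg.eps)
    have f₄ := Int.lt_floor_add_one
      ((k * cfg.eps - ⟪x t, S.thetaB cfg - S.thetaS cfg⟫) / cfg.eps)
    rw [← hk, le_div_iff₀ hε] at f₁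
    rw [← hk, div_lt_iff₀ hε] at f₂
    rw [← hk', le_div_iff₀ hε, inner_sub_right] at f₃
    rw [← hk', div_lt_iff₀ hε, inner_sub_right] at f₄
    -- Here `6ε ≤ C` is needed: margins are at most `2P - C`, and the errors are `4ε` from the
    -- parameters and `ε` from each of the two roundings.
    have hmem : (k, k') ∈ S.pairs cfg (x t) := by
      simp only [State.pairs, Finset.mem_filter, Finset.mem_product]
      refine ⟨⟨mem_grid_of_abs_le hε ?_, mem_grid_of_abs_le hε ?_⟩, hk'⟩ <;>
      · rw [abs_le]
        constructor <;> linarith [hp.1, hp.2]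
    refine ⟨_, hmem, ?_⟩
    have hsc := abs_le.1 (hscore _ hmem)
    dsimp only at hsc
    set q := ⟪x t, S.thetaS cfg⟫ + k * cfg.eps with hq
    have hqp : q ≤ p := by linarith
    have hpq : p - q ≤ cfg.eps := by linarith
    have d₁ : |F (p - ⟪x t, θs⟫) - F (q - ⟪x t, θs⟫)| ≤ L * cfg.eps := by
      rw [abs_of_nonneg (sub_nonneg.2 (hs.cdfAt_mono (by linarith)))]
      refine (hs.cdfAt_sub_le (by linarith)).trans ?_
      gcongr
      linarith
    have d₂ : |G (⟪x t, θb⟫ - p) - G (⟪x t, θb⟫ - q)| ≤ L * cfg.eps := by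
      rw [abs_sub_comm, abs_of_nonneg (sub_nonneg.2 (hb.map_neg.cdfAt_mono (by linarith)))]
      refine (hb.map_neg.cdfAt_sub_le (by linarith)).trans ?_
      gcongr
      linarith
    have d₃ : |Jt (p - ⟪x t, θs⟫) - Jt (q - ⟪x t, θs⟫)| ≤ cfg.eps := by
      rw [abs_of_nonneg (sub_nonneg.2 (clippedSurplus_mono hs (by linarith)))]
      exact (clippedSurplus_sub_le hs hne (by linarith)).trans (by linarith)
    have d₄ : |It (⟪x t, θb⟫ - p) - It (⟪x t, θb⟫ - q)| ≤ cfg.eps := by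
      rw [abs_sub_comm, abs_of_nonneg (sub_nonneg.2 (clippedSurplus_mono hb.map_neg (by linarith)))]
      exact (clippedSurplus_sub_le hb.map_neg hne (by linarith)).trans (by linarith)
    have m₁ := le_of_abs_le (abs_mul_sub_mul_le (bF _) (bI _) d₁ d₄)
    have m₂ := le_of_abs_le (abs_mul_sub_mul_le (bG _) (bJ _) d₂ d₃)
    rw [tradeValue] at hsc ⊢
    linarith [hsc.1]
  -- the pair that the algorithm takes
  have hbest : (S.best cfg (x t)).Nonempty := by
    obtain ⟨a, ha, -⟩ := hcover 0 ⟨by linarith, hP.le⟩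
    obtain ⟨a', ha', hmax⟩ := (S.pairs cfg (x t)).exists_max_image S.score ⟨a, ha⟩
    exact ⟨a', Finset.mem_filter.2 ⟨ha', hmax⟩⟩
  have htie := ch.tie_mem t _ hbest
  set c := ch.tie t (S.best cfg (x t)) with hc
  obtain ⟨hcp, hcmax⟩ := Finset.mem_filter.1 htie
  obtain ⟨g₁, g₂, g₃, g₄⟩ := hpos c hcp
  have hprice : priceAt cfg ch x u s b t = ⟪x t, S.thetaS cfg⟫ + c.1 * cfg.eps :=
    priceAt_commit hφ
  have b₁ := le_of_abs_le (abs_le_of_mem_grid hε hP.le g₁)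
  have b₂ := neg_le_of_abs_le (abs_le_of_mem_grid hε hP.le g₂)
  rw [hprice, egft_self_eq _ _ _ hs hb, egft_self_eq _ _ _ hs hb]
  -- The chosen margins are at most `2P + 4ε + 5ε ≤ 4P`, so `N = 4P`. The error is twice the score
  -- accuracy, once for each of the compared prices, plus the discretization error `(2 + 4PL)ε`.
  refine tradeValue_sub_le (supplyCurve hs hne fun l => (hbS l).1)
    (supplyCurve hb.map_neg hne fun l => (hbB l).1) hC (by positivity) (hθs t) (hθb t)
    (by linarith [(abs_le.1 g₃).2]) (by linarith [(abs_le.1 g₄).2]) (fun p hp => ?_) p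
  obtain ⟨a, ha, hle⟩ := hcover p hp
  change tradeValue F Jt G It _ _ ≤ tradeValue F Jt G It _ _ + _
  linarith [hcmax a ha, (abs_le.1 (hscore c hcp)).2]

end Commit

/-! ### The inputs of the algorithm for a large horizon -/

lemma tendsto_epsOf : Filter.Tendsto epsOf Filter.atTop (nhds 0) := by
  have h₁ : Filter.Tendsto (fun T : ℕ => Real.log T / T) Filter.atTop (nhds 0) :=
    Real.isLittleO_log_id_atTop.tendsto_div_nhds_zero.comp tendsto_natCast_atTop_atTop
  have h₂ := h₁.rpow_const (p := (1 / 4 : ℝ)) (.inr (by norm_num))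
  rwa [Real.zero_rpow (by norm_num)] at h₂

/-- Requirements on the horizon. -/
structure LargeHorizon (d : ℕ) (A B C : ℝ) (T : ℕ) : Prop where
  three_le : (3 : ℝ) ≤ T
  le_one : 74 + 32 * (C + A * B) ≤ (T : ℝ)
  le_two : d + 1 + B ^ 2 ≤ (T : ℝ)
  eps_le : 6 * epsOf T ≤ C

lemma exists_largeHorizon (d : ℕ) (A B : ℝ) {C : ℝ} (hC : 0 < C) :
    ∃ T₀ : ℕ, ∀ T, T₀ ≤ T → LargeHorizon d A B C T := by
  have hT : ∀ r : ℝ, ∀ᶠ T : ℕ in Filter.atTop, r ≤ T := fun r =>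
    tendsto_natCast_atTop_atTop.eventually_ge_atTop r
  have hε : ∀ᶠ T : ℕ in Filter.atTop, epsOf T < C / 6 :=
    tendsto_epsOf.eventually_lt_const (by positivity)
  refine Filter.eventually_atTop.1 ?_
  filter_upwards [hT 3, hT (74 + 32 * (C + A * B)), hT (d + 1 + B ^ 2), hε] with T h₁ h₂ h₃ h₄
  exact ⟨h₁, h₂, h₃, by linarith⟩

namespace LargeHorizon

variable {A B C : ℝ} {T : ℕ}

lemma one_le_log (h : LargeHorizon d A B C T) : 1 ≤ Real.log T := by
  rw [Real.le_log_iff_exp_le (by linarith [h.three_le])]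
  linarith [h.three_le, Real.exp_one_lt_d9]

/-- With `g = (log T)^{1/4}` and `r = T^{1/4}`, the later estimates on `ε` become inequalities
between powers of `g` and `r`. -/
lemma exists_eps_eq (h : LargeHorizon d A B C T) : ∃ g r : ℝ, 1 ≤ g ∧ g ≤ r ∧ g ≤ Real.log T ∧
    epsOf T = g / r ∧ (T : ℝ) = r ^ 4 ∧ (T : ℝ) ^ (3 / 4 : ℝ) = r ^ 3 := by
  have hT : (0 : ℝ) ≤ T := by linarith [h.three_le]
  have hlog := h.one_le_log
  refine ⟨Real.log T ^ (1 / 4 : ℝ), (T : ℝ) ^ (1 / 4 : ℝ), Real.one_le_rpow hlog (by norm_num),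
    Real.rpow_le_rpow (by linarith) (Real.log_le_self hT) (by norm_num), ?_, ?_, ?_, ?_⟩
  · calc _ ≤ Real.log T ^ (1 : ℝ) := Real.rpow_le_rpow_of_exponent_le hlog (by norm_num)
      _ = _ := Real.rpow_one _
  · rw [epsOf, Real.div_rpow (by linarith) hT]
  · rw [← Real.rpow_natCast, ← Real.rpow_mul hT]
    norm_num
  · rw [← Real.rpow_natCast, ← Real.rpow_mul hT]
    norm_num

lemma eps_pos (h : LargeHorizon d A B C T) : 0 < epsOf T := by
  obtain ⟨g, r, hg, hgr, -, he, -⟩ := h.exists_eps_eq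
  rw [he]
  have : 0 < r := by linarith
  positivity

lemma one_le_inv_eps (h : LargeHorizon d A B C T) : 1 ≤ (epsOf T)⁻¹ := by
  obtain ⟨g, r, hg, hgr, -, he, -⟩ := h.exists_eps_eq
  rw [he, inv_div, one_le_div (by linarith)]
  exact hgr

lemma inv_eps_pow_three_le (h : LargeHorizon d A B C T) :
    (epsOf T)⁻¹ ^ 3 ≤ (T : ℝ) ^ (3 / 4 : ℝ) := by
  obtain ⟨g, r, hg, hgr, -, he, -, hN⟩ := h.exists_eps_eq
  rw [he, hN, inv_div]
  have : 0 < r := by linarith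
  gcongr
  exact div_le_self (by linarith) hg

lemma inv_eps_le (h : LargeHorizon d A B C T) : (epsOf T)⁻¹ ≤ T := by
  obtain ⟨g, r, hg, hgr, -, he, hT, -⟩ := h.exists_eps_eq
  rw [he, hT, inv_div]
  exact (div_le_self (by linarith) hg).trans (le_self_pow₀ (by linarith) (by norm_num))

lemma mul_eps_le (h : LargeHorizon d A B C T) :
    T * epsOf T ≤ (T : ℝ) ^ (3 / 4 : ℝ) * Real.log T ^ 2 := by
  obtain ⟨g, r, hg, hgr, hgl, he, hT, hN⟩ := h.exists_eps_eq
  have hr : 0 < r := by linarith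
  have heq : r ^ 4 * (g / r) = r ^ 3 * g := by
    rw [pow_succ, mul_assoc, mul_div_cancel₀ _ hr.ne']
  calc T * epsOf T = r ^ 3 * g := by rw [he, hT, heq]
    _ ≤ _ := by
      rw [hN]
      gcongr
      exact hgl.trans (le_self_pow₀ h.one_le_log two_ne_zero)

/-- The number `1/δ` is the product of `T` and this one. -/
lemma one_div_delta (P : ℝ) : 1 / deltaOf P T = T * (74 + 32 * P * (epsOf T)⁻¹) := by
  rw [deltaOf, one_div, inv_inv]

lemma log_add_le (h : LargeHorizon d A B C T) {a : ℝ} (ha : 0 < a) (hT : a + B ^ 2 ≤ T) :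
    Real.log (a + B ^ 2 * T) ≤ 2 * Real.log T := by
  have h₁ := h.three_le
  have h₂ : 2 * Real.log T = Real.log ((T : ℝ) ^ 2) := by rw [Real.log_pow, Nat.cast_ofNat]
  rw [h₂]
  refine Real.log_le_log (by positivity) ?_
  nlinarith

lemma P_pos (hC : 0 < C) (hA : 0 ≤ A) (hB : 0 ≤ B)
    : 0 < C + A * B := by positivity

lemma le_factor (hC : 0 < C) (hA : 0 ≤ A) (hB : 0 ≤ B)
    (h : LargeHorizon d A B C T) :
    74 ≤ 74 + 32 * (C + A * B) * (epsOf T)⁻¹ := by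
  have := P_pos hC hA hB
  have := h.eps_pos
  exact le_add_of_nonneg_right (by positivity)

lemma one_lt_one_div_delta (hC : 0 < C) (hA : 0 ≤ A) (hB : 0 ≤ B)
    (h : LargeHorizon d A B C T) : 1 < 1 / deltaOf (C + A * B) T := by
  have := h.le_factor hC hA hB
  rw [one_div_delta]
  nlinarith [h.three_le]

lemma log_pos (hC : 0 < C) (hA : 0 ≤ A) (hB : 0 ≤ B)
    (h : LargeHorizon d A B C T) : 0 < Real.log (1 / deltaOf (C + A * B) T) :=
  Real.log_pos (h.one_lt_one_div_delta hC hA hB)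

lemma log_le (hC : 0 < C) (hA : 0 ≤ A) (hB : 0 ≤ B)
    (h : LargeHorizon d A B C T) :
    Real.log (1 / deltaOf (C + A * B) T) ≤ 3 * Real.log T := by
  have hP := P_pos hC hA hB
  have h₁ := h.three_le
  rw [← Nat.cast_ofNat (n := 3), ← Real.log_pow]
  refine Real.log_le_log (by linarith [h.one_lt_one_div_delta hC hA hB]) ?_
  rw [one_div_delta, pow_succ', pow_two]
  gcongr
  calc 74 + 32 * (C + A * B) * (epsOf T)⁻¹
      ≤ 74 * (epsOf T)⁻¹ + 32 * (C + A * B) * (epsOf T)⁻¹ := by linarith [h.one_le_inv_eps]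
    _ = (74 + 32 * (C + A * B)) * (epsOf T)⁻¹ := by ring
    _ ≤ T * T := by
      gcongr
      · linarith [h.one_le_inv_eps]
      · exact h.le_one
      · exact h.inv_eps_le

lemma log_div_eq (hC : 0 < C) (hA : 0 ≤ A) (hB : 0 ≤ B)
    (h : LargeHorizon d A B C T) :
    Real.log ((1 + B ^ 2 * T) / deltaOf (C + A * B) T) =
      Real.log (1 + B ^ 2 * T) + Real.log (1 / deltaOf (C + A * B) T) := by
  have h₁ := h.three_le
  have h₂ := h.one_lt_one_div_delta hC hA hB
  rw [← Real.log_mul (by positivity) (by linarith), mul_one_div]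

/-- The actual `μ` is smaller than required: for `d ≥ 1` the quantity under its square root is at
least `log (1/δ)`. -/
lemma tuned (hC : 0 < C) (hA : 0 ≤ A) (hB : 0 ≤ B)
    (h : LargeHorizon d A B C T) (hd : 0 < d) :
    (configOf d A B C T).Tuned A (Real.log (1 / deltaOf (C + A * B) T)) := by
  have hP := P_pos hC hA hB
  have hε := h.eps_pos
  have hℓ := h.log_pos hC hA hB
  have hd' : (1 : ℝ) ≤ d := by exact_mod_cast hd
  have hsqrt : √(Real.log (1 / deltaOf (C + A * B) T)) ≤
      √(d * Real.log ((1 + B ^ 2 * T) / deltaOf (C + A * B) T)) := by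
    refine Real.sqrt_le_sqrt ?_
    rw [h.log_div_eq hC hA hB]
    have : 0 ≤ Real.log (1 + B ^ 2 * T) := Real.log_nonneg (le_add_of_nonneg_right (by positivity))
    nlinarith
  have hpos : 0 < (C + A * B) * √(Real.log (1 / deltaOf (C + A * B) T)) + A :=
    add_pos_of_pos_of_nonneg (mul_pos hP (Real.sqrt_pos.2 hℓ)) hA
  have hle : (C + A * B) * √(Real.log (1 / deltaOf (C + A * B) T)) + A ≤
      (C + A * B) * √(d * Real.log ((1 + B ^ 2 * T) / deltaOf (C + A * B) T)) + A := by gcongr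
  refine ⟨hε, mul_pos hε (inv_pos.2 (hpos.trans_le hle)), hℓ, ?_, ?_, ?_⟩
  · simp only [configOf]
    rw [mul_assoc]
    refine mul_le_of_le_one_right hε.le ?_
    rw [inv_mul_le_iff₀ (hpos.trans_le hle), mul_one]
    exact hle
  · simp only [configOf]
    rw [← div_le_iff₀ (by positivity), div_eq_mul_inv]
    exact Nat.le_ceil _
  · simp only [configOf]
    rw [← div_le_iff₀ (by positivity), div_eq_mul_inv]
    exact Nat.le_ceil _

lemma Tint_pos (hC : 0 < C) (hA : 0 ≤ A) (hB : 0 ≤ B)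
    (h : LargeHorizon d A B C T) : 0 < (configOf d A B C T).Tint := by
  have := P_pos hC hA hB
  have := h.eps_pos
  have := h.log_pos hC hA hB
  exact Nat.ceil_pos.2 (by positivity)

lemma K_le (hC : 0 < C) (hA : 0 ≤ A) (hB : 0 ≤ B)
    (h : LargeHorizon d A B C T) :
    ((configOf d A B C T).K : ℝ) ≤ 2 * (C + A * B) * (epsOf T)⁻¹ + 4 := by
  have := P_pos hC hA hB
  have := h.eps_pos
  rw [Config.K]
  simp only [configOf]
  push_cast
  rw [← div_eq_mul_inv]
  linarith [(Nat.ceil_lt_add_one (by positivity : 0 ≤ 2 * (C + A * B) / epsOf T)).le]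

lemma card_extGrid_le (hC : 0 < C) (hA : 0 ≤ A) (hB : 0 ≤ B)
    (h : LargeHorizon d A B C T) :
    ((configOf d A B C T).extGrid.card : ℝ) ≤ 74 + 32 * (C + A * B) * (epsOf T)⁻¹ := by
  have hcard : (configOf d A B C T).extGrid.card = 2 * (configOf d A B C T).K + 9 := by
    rw [Config.extGrid, Int.card_Icc]
    omega
  have hP := P_pos hC hA hB
  have hε := h.eps_pos
  have : 0 ≤ (C + A * B) * (epsOf T)⁻¹ := by positivity
  rw [hcard]
  push_cast
  linarith [h.K_le hC hA hB]

/-- The total probability of the bad events. -/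
lemma failure_le (hC : 0 < C) (hA : 0 ≤ A) (hB : 0 ≤ B)
    (h : LargeHorizon d A B C T) {n : ℝ} (hn₀ : 0 ≤ n)
    (hn : n ≤ 74 + 32 * (C + A * B) * (epsOf T)⁻¹) :
    2 * ((T * (T + 1) + (T + 1) * (n * n) + (T + 1) * n) *
      (2 * Real.exp (-(8 * Real.log (1 / deltaOf (C + A * B) T))))) ≤ 1 / T := by
  have h₁ := h.three_le
  have h₂ := h.le_factor hC hA hB
  have h₃ := h.one_lt_one_div_delta hC hA hB
  set D := 74 + 32 * (C + A * B) * (epsOf T)⁻¹ with hD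
  -- The confidence level is `δ⁸`, far smaller than needed: the number of events is at most of order
  -- `(1/δ)²`, and the surplus powers absorb every constant.
  have hexp : Real.exp (-(8 * Real.log (1 / deltaOf (C + A * B) T))) = ((T * D) ^ 8)⁻¹ := by
    rw [Real.exp_neg, ← Nat.cast_ofNat (n := 8), ← Real.log_pow, Real.exp_log (by positivity),
      one_div_delta]
  have hy : 74 * (T : ℝ) ≤ T * D := by nlinarith
  have hsum : T * (T + 1) + (T + 1) * (n * n) + (T + 1) * n ≤ 6 * (T * D) ^ 2 := by
    have hT : (T : ℝ) + 1 ≤ 2 * T := by linarith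
    have hTT : (T : ℝ) ≤ T * D := by nlinarith
    have hDT : D ≤ T * D := by nlinarith
    have e₁ : (T : ℝ) * (T + 1) ≤ (T * D) * (2 * (T * D)) :=
      mul_le_mul hTT (by linarith) (by linarith) (by positivity)
    have e₂ : ((T : ℝ) + 1) * (n * n) ≤ 2 * T * (D * D) := by gcongr
    have e₃ : ((T : ℝ) + 1) * n ≤ 2 * T * D := by gcongr
    nlinarith
  set y := T * D with hydef
  have hy1 : 1 ≤ y := by linarith
  rw [hexp]
  calc _ ≤ 2 * ((6 * y ^ 2) * (2 * (y ^ 8)⁻¹)) := by gcongr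
    _ = 24 / y ^ 6 := by field_simp; norm_num
    _ ≤ 24 / y := by
      gcongr
      exact le_self_pow₀ hy1 (by norm_num)
    _ ≤ 1 / T := by
      rw [div_le_div_iff₀ (by linarith) (by linarith)]
      linarith

lemma explorationRounds_le (hC : 0 < C) (hA : 0 ≤ A) (hB : 0 ≤ B)
    (h : LargeHorizon d A B C T) (hd : 0 < d) (ch : Choice)
    {x : ℕ → EuclideanSpace ℝ (Fin d)} (hx : ∀ t, ‖x t‖ ≤ B) (u s b : ℕ → ℝ) :
    (explorationRounds (configOf d A B C T) ch x u s b T : ℝ) ≤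
      (2 * d * (1 + ((C + A * B) * √(5 * d) + A) ^ 2) + (24 * (C + A * B) ^ 2 + 1) +
        14 * (4 * (C + A * B) + 9)) * ((T : ℝ) ^ (3 / 4 : ℝ) * Real.log T ^ 2) := by
  have hP := P_pos hC hA hB
  have hε := h.eps_pos
  have hι := h.one_le_inv_eps
  have hlog := h.one_le_log
  have hℓ := h.log_pos hC hA hB
  have hℓ' := h.log_le hC hA hB
  have hK := h.K_le hC hA hB
  have hd' : (1 : ℝ) ≤ d := by exact_mod_cast hd
  have hmain := BilateralTrade.explorationRounds_le (cfg := configOf d A B C T) (ch := ch)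
    (x := x) (u := u) (s := s) (b := b) T
  have hpar := card_estPar_le (x := x) (h.tuned hC hA hB hd).mu_pos hx
    (fun t ht => mu_lt_of_phaseAt (ch := ch) (u := u) (s := s) (b := b) (t := t) ht) T
  have hmu : ((configOf d A B C T).mu ^ 2)⁻¹ ≤
      (epsOf T)⁻¹ ^ 2 * (((C + A * B) * √(5 * d) + A) ^ 2 * Real.log T) := by
    have hDen : (C + A * B) * √(d * Real.log ((1 + B ^ 2 * T) / deltaOf (C + A * B) T)) + A ≤
        ((C + A * B) * √(5 * d) + A) * √(Real.log T) := by
      -- The `5` is `2 + 3`: the growth of the Gram matrix and `log (1/δ)`.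
      have h₁ : Real.log ((1 + B ^ 2 * T) / deltaOf (C + A * B) T) ≤ 5 * Real.log T := by
        rw [h.log_div_eq hC hA hB]
        linarith [h.log_add_le one_pos (by linarith [h.le_two])]
      have h₂ : √(d * Real.log ((1 + B ^ 2 * T) / deltaOf (C + A * B) T)) ≤
          √(5 * d) * √(Real.log T) := by
        rw [← Real.sqrt_mul (by positivity)]
        refine Real.sqrt_le_sqrt ?_
        nlinarith
      have h₃ : 1 ≤ √(Real.log T) := Real.one_le_sqrt.2 hlog
      nlinarith
    have hDen₀ : 0 ≤
        (C + A * B) * √(d * Real.log ((1 + B ^ 2 * T) / deltaOf (C + A * B) T)) + A := by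
      positivity
    simp only [configOf]
    rw [mul_pow, inv_pow, mul_inv, inv_inv, inv_pow]
    gcongr
    calc _ ≤ (((C + A * B) * √(5 * d) + A) * √(Real.log T)) ^ 2 := by gcongr
      _ = _ := by rw [mul_pow, Real.sq_sqrt (by linarith)]
  have hlogd := h.log_add_le (a := d) (by linarith) (by linarith [h.le_two])
  have hlogd₀ : 0 ≤ Real.log (d + B ^ 2 * T) :=
    Real.log_nonneg (hd'.trans (le_add_of_nonneg_right (by positivity)))
  set N := (T : ℝ) ^ (3 / 4 : ℝ) with hN
  set Λ := Real.log T with hΛ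
  set ι := (epsOf T)⁻¹ with hιdef
  set P := C + A * B with hPdef
  set Q := P * √(5 * d) + A with hQ
  have hι3 : ι ^ 3 ≤ N := h.inv_eps_pow_three_le
  have hι2 : ι ^ 2 ≤ N := (pow_le_pow_right₀ hι (by norm_num)).trans hι3
  have hN1 : 1 ≤ N := (one_le_pow₀ hι).trans hι3
  have hNΛ : 1 ≤ N * Λ := by nlinarith
  have hΛ2 : Λ ≤ Λ ^ 2 := le_self_pow₀ hlog (by norm_num)
  -- The only term that needs the square of the logarithm: one factor comes from `μ⁻²`, the other
  -- from the log-determinant.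
  have c₁ : ((roundsOf (phaseAt (configOf d A B C T) ch x u s b) T .estPar).card : ℝ) ≤
      2 * d * (1 + Q ^ 2) * (N * Λ ^ 2) := by
    calc _ ≤ _ := hpar
      _ ≤ (1 + ι ^ 2 * (Q ^ 2 * Λ)) * (d * (2 * Λ)) := by gcongr
      _ ≤ (N * Λ + N * (Q ^ 2 * Λ)) * (d * (2 * Λ)) := by gcongr
      _ = _ := by ring
  have c₂ : ((configOf d A B C T).Tint : ℝ) ≤ (24 * P ^ 2 + 1) * (N * Λ ^ 2) := by
    have : ((configOf d A B C T).Tint : ℝ) ≤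
        8 * P ^ 2 * Real.log (1 / deltaOf P T) * (epsOf T ^ 2)⁻¹ + 1 :=
      (Nat.ceil_lt_add_one (by positivity)).le
    rw [← inv_pow, ← hιdef] at this
    calc _ ≤ _ := this
      _ ≤ 8 * P ^ 2 * (3 * Λ) * N + N * Λ := by gcongr
      _ = (24 * P ^ 2 + 1) * (N * Λ) := by ring
      _ ≤ _ := by gcongr
  have c₃ : 2 * (2 * ((configOf d A B C T).K : ℝ) + 1) * (configOf d A B C T).TFD ≤
      14 * (4 * P + 9) * (N * Λ ^ 2) := by
    have h₁ : ((configOf d A B C T).TFD : ℝ) ≤ 7 * Λ * ι ^ 2 := by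
      have : ((configOf d A B C T).TFD : ℝ) ≤
          2 * Real.log (1 / deltaOf P T) * (epsOf T ^ 2)⁻¹ + 1 :=
        (Nat.ceil_lt_add_one (by positivity)).le
      rw [← inv_pow, ← hιdef] at this
      have hι2' : 1 ≤ Λ * ι ^ 2 := one_le_mul_of_one_le_of_one_le hlog (one_le_pow₀ hι)
      calc _ ≤ _ := this
        _ ≤ 2 * (3 * Λ) * ι ^ 2 + Λ * ι ^ 2 := by gcongr
        _ = _ := by ring
    have h₂ : 2 * ((configOf d A B C T).K : ℝ) + 1 ≤ (4 * P + 9) * ι := by linarith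
    calc _ ≤ 2 * ((4 * P + 9) * ι) * (7 * Λ * ι ^ 2) := by gcongr
      _ = 14 * (4 * P + 9) * (ι ^ 3 * Λ) := by ring
      _ ≤ _ := by gcongr
  have hmain' := (Nat.cast_le (α := ℝ)).2 hmain
  push_cast at hmain'
  linarith

end LargeHorizon

/-! ### The theorem -/

section Main

variable {A B C L : ℝ} {θs θb : EuclideanSpace ℝ (Fin d)} {νs νb : Measure ℝ}

lemma abs_inner_le_of_norm_le {x θ : EuclideanSpace ℝ (Fin d)} (hx : ‖x‖ ≤ B) (hθ : ‖θ‖ ≤ A) :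
    |⟪x, θ⟫| ≤ A * B :=
  (abs_real_inner_le_norm x θ).trans <| by
    rw [mul_comm]
    exact mul_le_mul hθ hx (norm_nonneg _) ((norm_nonneg _).trans hθ)

/-- Exploration rounds are charged the trivial bound `4P`. The commit bound is nonnegative and is
charged to every round, which avoids counting the commit rounds. -/
lemma regret_le_of_goodRun {cfg : Config} {ch : Choice} {x : ℕ → EuclideanSpace ℝ (Fin d)} {T : ℕ}
    {u s b : ℕ → ℝ} (h : GoodRun cfg ch x T θs θb νs νb u s b) (hs : IsNoiseLaw C L νs)
    (hb : IsNoiseLaw C L νb) (hε : 0 < cfg.eps) (hεC : 6 * cfg.eps ≤ C) (hTint : 0 < cfg.Tint)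
    (hθs : ∀ l, |⟪x l, θs⟫| ≤ cfg.P - C) (hθb : ∀ l, |⟪x l, θb⟫| ≤ cfg.P - C) :
    regret cfg.P θs θb νs νb x (priceAt cfg ch x u s b) T ≤
      4 * cfg.P * explorationRounds cfg ch x u s b T +
        (1 + 4 * cfg.P / C) * (46 + 16 * cfg.P + 76 * cfg.P * L) * (T * cfg.eps) := by
  have hC := hs.C_pos
  have hL := hs.L_nonneg
  have hP : 0 < cfg.P := by linarith [(abs_nonneg _).trans (hθs 0)]
  set E := (1 + 4 * cfg.P / C) * ((46 + 16 * cfg.P + 76 * cfg.P * L) * cfg.eps) with hE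
  have hE₀ : 0 ≤ E := by positivity
  have hround : ∀ t ∈ Finset.range T, bestEgft cfg.P θs θb νs νb (x t) -
      egft θs θb νs νb (x t) (priceAt cfg ch x u s b t) (priceAt cfg ch x u s b t) ≤
      (if phaseAt cfg ch x u s b t ≠ .commit then 4 * cfg.P else 0) + E := by
    intro t ht
    rw [sub_le_iff_le_add]
    refine bestEgft_le θs θb (x t) hs hb hP.le fun p hp => ?_
    split_ifs with hφ
    · linarith [egft_self_le θs θb (x t) hs hb (hθs t) (hθb t) hp,
        egft_self_nonneg θs θb (x t) hs hb (priceAt cfg ch x u s b t)]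
    · linarith [h.egft_sub_le hs hb hε hεC hTint hθs hθb (Finset.mem_range.1 ht)
        (not_not.1 hφ) p]
  rw [regret, ← Finset.sum_sub_distrib]
  refine (Finset.sum_le_sum hround).trans (le_of_eq ?_)
  rw [Finset.sum_add_distrib, ← Finset.sum_filter, Finset.sum_const, Finset.sum_const,
    Finset.card_range, nsmul_eq_mul, nsmul_eq_mul, explorationRounds, hE]
  ring

lemma measure_not_goodRun_le {Ω : Type*} [MeasurableSpace Ω] {μ : Measure Ω}
    [IsProbabilityMeasure μ] {U ξs ξb : ℕ → Ω → ℝ} {cfg : Config} {ℓ : ℝ}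
    {x : ℕ → EuclideanSpace ℝ (Fin d)} (hs : IsNoiseLaw C L νs) (hb : IsNoiseLaw C L νb)
    (hM : IsModel μ cfg.P νs νb U ξs ξb) (hcfg : cfg.Tuned A ℓ) (hAs : ‖θs‖ ≤ A) (hAb : ‖θb‖ ≤ A)
    (hθs : ∀ l, |⟪x l, θs⟫| ≤ cfg.P - C) (hθb : ∀ l, |⟪x l, θb⟫| ≤ cfg.P - C) (ch : Choice)
    (T : ℕ) :
    μ.real {ω | ¬ GoodRun cfg ch x T θs θb νs νb (fun t => U t ω)
      (fun t => ⟪x t, θs⟫ + ξs t ω) (fun t => ⟪x t, θb⟫ + ξb t ω)} ≤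
      2 * ((T * (T + 1) + (T + 1) * (cfg.extGrid.card * cfg.extGrid.card)
        + (T + 1) * cfg.extGrid.card) * (2 * Real.exp (-(8 * ℓ)))) := by
  -- The common sequence of kinds is computed on all-zero inputs; this makes it a constant to which
  -- the concentration bounds apply.
  have hψ (u s b : ℕ → ℝ) := phaseAt_congr cfg ch x u s b 0 0 0
  set ψ := phaseAt cfg ch x 0 0 0
  have h₁ := measure_not_goodSide_le hM.seller hs hcfg hAs hθs T ψ .estF
  have h₂ := measure_not_goodSide_le hM.buyer hb.map_neg hcfg (θ := -θb) (by rwa [norm_neg])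
    (fun l => by rw [inner_neg_right, abs_neg]; exact hθb l) T ψ .estD
  rw [two_mul]
  refine (measureReal_mono ?_).trans ((measureReal_union_le _ _).trans (add_le_add h₁ h₂))
  intro ω hω
  by_contra hcon
  rw [Set.mem_union, not_or] at hcon
  simp only [Set.mem_ofPred_eq, not_not] at hcon
  refine hω ⟨?_, ?_⟩
  · simpa only [hψ, add_sub_cancel_left] using hcon.1
  · simpa only [hψ, sub_add_cancel_left] using hcon.2

end Main

end BilateralTrade
end
open BilateralTrade in
theorem theorem2 :
    -- the exponent of the logarithm is absolute
    ∃ κ : ℕ, ∀ (d : ℕ) (A B C L : ℝ), 0 < d → 0 ≤ A → 0 ≤ B →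
      -- the remaining constants depend on `d`, `A`, `B`, `C`, `L` only
      ∃ (c : ℝ) (T₀ : ℕ), ∀ T : ℕ, T₀ ≤ T →
        ∀ (θs θb : EuclideanSpace ℝ (Fin d)), ‖θs‖ ≤ A → ‖θb‖ ≤ A →
        ∀ (x : ℕ → EuclideanSpace ℝ (Fin d)), (∀ t, ‖x t‖ ≤ B) →
        ∀ (νs νb : Measure ℝ), IsNoiseLaw C L νs → IsNoiseLaw C L νb →
        ∀ {Ω : Type*} [MeasurableSpace Ω] (μ : Measure Ω) [IsProbabilityMeasure μ]
          (U ξs ξb : ℕ → Ω → ℝ), IsModel μ (C + A * B) νs νb U ξs ξb →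
        ∀ ch : Choice,
          -- the number of exploration rounds
          (∀ ω, (explorationRounds (configOf d A B C T) ch x (fun t => U t ω)
                (fun t => inner ℝ (x t) θs + ξs t ω) (fun t => inner ℝ (x t) θb + ξb t ω) T : ℝ)
              ≤ c * (T : ℝ) ^ (3 / 4 : ℝ) * Real.log T ^ κ) ∧
          -- the regret
          1 - 1 / (T : ℝ) ≤ μ.real {ω |
            regret (C + A * B) θs θb νs νb x
                (priceAt (configOf d A B C T) ch x (fun t => U t ω)
                  (fun t => inner ℝ (x t) θs + ξs t ω) (fun t => inner ℝ (x t) θb + ξb t ω)) T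
              ≤ c * (T : ℝ) ^ (3 / 4 : ℝ) * Real.log T ^ κ} := by
  refine ⟨2, fun d A B C L hd hA hB => ?_⟩
  -- No noise law exists when `C ≤ 0`, so any constants do.
  rcases le_or_gt C 0 with hC | hC
  · exact ⟨0, 0, fun T _ θs θb _ _ x _ νs νb hs => absurd hs.C_pos hC.not_gt⟩
  obtain ⟨T₀, hT₀⟩ := exists_largeHorizon d A B hC
  have hP := LargeHorizon.P_pos hC hA hB
  set P := C + A * B with hPdef
  set c₁ : ℝ := 2 * d * (1 + (P * √(5 * d) + A) ^ 2) + (24 * P ^ 2 + 1) + 14 * (4 * P + 9) with hc₁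
  -- The constant is chosen before any noise law is available to force `L ≥ 0`, hence the absolute
  -- value.
  set c₂ : ℝ := (1 + 4 * P / C) * (46 + 16 * P + 76 * P * |L|) with hc₂
  have hc₁₀ : 0 ≤ c₁ := by positivity
  have hc₂₀ : 0 ≤ c₂ := by positivity
  refine ⟨(1 + 4 * P) * c₁ + c₂, T₀, fun T hT θs θb hAs hAb x hx νs νb hs hb Ω _ μ _ U ξs ξb hM ch =>
    ?_⟩
  have h := hT₀ T hT
  set R := (T : ℝ) ^ (3 / 4 : ℝ) * Real.log T ^ 2 with hR
  have hR₀ : 0 ≤ R := by positivity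
  have hexpl (ω : Ω) := h.explorationRounds_le hC hA hB hd ch hx (fun t => U t ω)
    (fun t => inner ℝ (x t) θs + ξs t ω) (fun t => inner ℝ (x t) θb + ξb t ω)
  rw [← hPdef, ← hc₁, ← hR] at hexpl
  have hθs : ∀ l, |inner ℝ (x l) θs| ≤ P - C := fun l => by
    rw [hPdef, add_sub_cancel_left]
    exact abs_inner_le_of_norm_le (hx l) hAs
  have hθb : ∀ l, |inner ℝ (x l) θb| ≤ P - C := fun l => by
    rw [hPdef, add_sub_cancel_left]
    exact abs_inner_le_of_norm_le (hx l) hAb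
  simp only [mul_assoc, ← hR]
  refine ⟨fun ω => (hexpl ω).trans ?_, ?_⟩
  · gcongr
    nlinarith
  have hbad := (measure_not_goodRun_le (cfg := configOf d A B C T) hs hb hM
    (h.tuned hC hA hB hd) hAs hAb hθs hθb ch T).trans
    (h.failure_le hC hA hB (Nat.cast_nonneg _) (h.card_extGrid_le hC hA hB))
  set good := {ω | GoodRun (configOf d A B C T) ch x T θs θb νs νb (fun t => U t ω)
    (fun t => inner ℝ (x t) θs + ξs t ω) (fun t => inner ℝ (x t) θb + ξb t ω)} with hgood
  have hsub : good ⊆ {ω | regret P θs θb νs νb x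
      (priceAt (configOf d A B C T) ch x (fun t => U t ω) (fun t => inner ℝ (x t) θs + ξs t ω)
        (fun t => inner ℝ (x t) θb + ξb t ω)) T ≤ ((1 + 4 * P) * c₁ + c₂) * R} := by
    intro ω hω
    have h₁ := regret_le_of_goodRun hω hs hb h.eps_pos h.eps_le (h.Tint_pos hC hA hB) hθs hθb
    have h₂ := h.mul_eps_le
    rw [← hR] at h₂
    refine h₁.trans ?_
    have h₃ : (1 + 4 * P / C) * (46 + 16 * P + 76 * P * L) ≤ c₂ := by
      rw [hc₂]
      gcongr
      exact le_abs_self L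
    have h₄ : (1 + 4 * P / C) * (46 + 16 * P + 76 * P * L) * (T * epsOf T) ≤ c₂ * R :=
      mul_le_mul h₃ h₂ (mul_nonneg (Nat.cast_nonneg _) h.eps_pos.le) hc₂₀
    have h₅ := mul_le_mul_of_nonneg_left (hexpl ω) (by positivity : 0 ≤ 4 * P)
    have h₆ : 0 ≤ c₁ * R := mul_nonneg hc₁₀ hR₀
    change 4 * P * _ + (1 + 4 * P / C) * (46 + 16 * P + 76 * P * L) * (T * epsOf T) ≤ _
    linarith
  -- Subadditivity is enough here, so the good event need not be shown measurable.
  have huniv : 1 ≤ μ.real good + μ.real goodᶜ := by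
    have := measureReal_union_le (μ := μ) good goodᶜ
    rwa [Set.union_compl_self, probReal_univ] at this
  have hcompl : μ.real goodᶜ ≤ 1 / T := hbad
  linarith [measureReal_mono (μ := μ) hsub]
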